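/- Let $k$ be a field of characteristic $0$, let $U$ be a $2$-dimensional $k$-vector space with dual $U^*$, and let $L$ be a set with $8$ elements. Let $$R=\Big[\bigoplus_{d\ge 0}(\mathrm{Sym}^d U^*)^{\otimes L}\Big]^{\mathrm{SL}(U)}$$ be the ring of projective invariants of $8$ points on $\mathbb{P}U$ labelled by $L$, let $V=[(U^*)^{\otimes L}]^{\mathrm{SL}(U)}$ be its degree-one piece, let $I$ be the kernel of the natural map $\mathrm{Sym}(V)\to R$ (the ideal of relations), and put $I^{(2)}=I\cap \mathrm{Sym}^2(V)$. The symmetric group $S_L=\mathrm{Aut}(L)$ acts on $V$ by permuting the tensor factors, and hence acts on $\mathrm{Sym}(V)$. For $\varphi\in V^*$ let $\partial_\varphi$ be the derivation of $\mathrm{Sym}(V)$ given by $\partial_\varphi(v_1\cdots v_n)=\sum_{i}\varphi(v_i)\,v_1\cdots\widehat{v_i}\cdots v_n$. Let $s\in \mathrm{Sym}^3(V)$ be non-zero and skew-invariant, i.e. $\sigma s=\mathrm{sgn}(\sigma)\,s$ for all $\sigma\in S_L$. Then $\dim_k V=14$, and for every basis $b_1,\dots,b_{14}$ of $V$, with dual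 basis $b_1^*,\dots,b_{14}^*$ of $V^*$, the $14$ partial derivatives $\partial_{b_1^*}s,\dots,\partial_{b_{14}^*}s$ are linearly independent and span $I^{(2)}$. -/

import Mathlib

open scoped TensorProduct

noncomputable section

namespace PointsOnLine

section Symmetric

variable (k : Type*) [Field k] {M N : Type*} [AddCommMonoid M] [Module k M]
  [AddCommMonoid N] [Module k N]

/-- The `d`-th symmetric power `Sym^d(M)`, as the degree `d` piece of the symmetric algebra. -/
def symPow (M : Type*) [AddCommMonoid M] [Module k M] (d : ℕ) :
    Submodule k (SymmetricAlgebra k M) :=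
  LinearMap.range (SymmetricAlgebra.ι k M) ^ d

/-- Functoriality of the symmetric algebra. -/
def symMap (f : M →ₗ[k] N) : SymmetricAlgebra k M →ₐ[k] SymmetricAlgebra k N :=
  SymmetricAlgebra.lift (SymmetricAlgebra.ι k N ∘ₗ f)

/-- The algebra map `p ↦ p + ε ∂_φ p` from `Sym(M)` to the dual numbers over `Sym(M)`. -/
def dualNumberHom (φ : Module.Dual k M) :
    SymmetricAlgebra k M →ₐ[k]
      TrivSqZeroExt (SymmetricAlgebra k M) (SymmetricAlgebra k M) :=
  SymmetricAlgebra.lift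
    ((TrivSqZeroExt.inlAlgHom k (SymmetricAlgebra k M) (SymmetricAlgebra k M)).toLinearMap ∘ₗ
        SymmetricAlgebra.ι k M +
      (TrivSqZeroExt.inrHom (SymmetricAlgebra k M) (SymmetricAlgebra k M)).restrictScalars k ∘ₗ
        Algebra.linearMap k (SymmetricAlgebra k M) ∘ₗ φ)

theorem fst_dualNumberHom (φ : Module.Dual k M) (p : SymmetricAlgebra k M) :
    (dualNumberHom k φ p).fst = p := by
  have h : (TrivSqZeroExt.fstHom k (SymmetricAlgebra k M) (SymmetricAlgebra k M)).comp
      (dualNumberHom k φ) = AlgHom.id k _ := by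
    apply SymmetricAlgebra.algHom_ext
    ext x
    simp [dualNumberHom]
  exact DFunLike.congr_fun h p

/-- For `φ` in the dual space `M*`, the derivation `∂_φ` of `Sym(M)` with
`∂_φ (v₁ ⋯ vₙ) = ∑ᵢ ⟨φ, vᵢ⟩ v₁ ⋯ v̂ᵢ ⋯ vₙ`: the unique `k`-linear derivation that is given by `φ` on
`M = Sym^1(M)`. -/
def partialDeriv (φ : Module.Dual k M) :
    Derivation k (SymmetricAlgebra k M) (SymmetricAlgebra k M) :=
  Derivation.mk'
    ((TrivSqZeroExt.sndHom (SymmetricAlgebra k M) (SymmetricAlgebra k M)).restrictScalars k ∘ₗ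
      (dualNumberHom k φ).toLinearMap)
    (fun a b => by
      simp [fst_dualNumberHom, mul_comm])

theorem partialDeriv_ι (φ : Module.Dual k M) (v : M) :
    partialDeriv k φ (SymmetricAlgebra.ι k M v) = algebraMap k _ (φ v) := by
  simp [partialDeriv, dualNumberHom, Algebra.algebraMap_eq_smul_one]

end Symmetric

section Invariants

variable (k : Type*) [Field k] (U : Type*) [AddCommGroup U] [Module k U] (L : Type*)

/-- The algebra `Sym(U*)^{⊗ L}`. -/
abbrev Ambient : Type _ := ⨂[k] _ : L, SymmetricAlgebra k (Module.Dual k U)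

/-- The piece `(Sym^d U*)^{⊗ L}` of `Sym(U*)^{⊗ L}`. -/
def diagPiece (d : ℕ) : Submodule k (Ambient k U L) :=
  Submodule.span k {x | ∃ f : L → SymmetricAlgebra k (Module.Dual k U),
    (∀ i, f i ∈ symPow k (Module.Dual k U) d) ∧ x = PiTensorProduct.tprod k f}

/-- The contragredient action of `g ∈ SL(U)` on `U*`. -/
def slDual (g : SpecialLinearGroup k U) : Module.Dual k U →ₗ[k] Module.Dual k U :=
  ((g⁻¹).toLinearEquiv : U →ₗ[k] U).dualMap

/-- The (diagonal) action of `g ∈ SL(U)` on `Sym(U*)^{⊗ L}`. -/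
def slAct (g : SpecialLinearGroup k U) : Ambient k U L →ₗ[k] Ambient k U L :=
  PiTensorProduct.map fun _ => (symMap k (slDual k U g)).toLinearMap

/-- The action of `σ ∈ S_L` on `Sym(U*)^{⊗ L}` by permuting the tensor factors. -/
def permAct (σ : Equiv.Perm L) : Ambient k U L →ₗ[k] Ambient k U L :=
  (PiTensorProduct.reindex k (fun _ : L => SymmetricAlgebra k (Module.Dual k U)) σ).toLinearMap

instance : IsScalarTower k (Ambient k U L) (Ambient k U L) :=
  IsScalarTower.right (R := k) (A := Ambient k U L)

instance : SMulCommClass k (Ambient k U L) (Ambient k U L) :=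
  Algebra.to_smulCommClass (R := k) (A := Ambient k U L)

variable {k U L}

theorem slAct_tprod (g : SpecialLinearGroup k U)
    (f : L → SymmetricAlgebra k (Module.Dual k U)) :
    slAct k U L g (PiTensorProduct.tprod k f) =
      PiTensorProduct.tprod k fun i => symMap k (slDual k U g) (f i) := by
  simp [slAct]

theorem permAct_tprod (σ : Equiv.Perm L) (f : L → SymmetricAlgebra k (Module.Dual k U)) :
    permAct k U L σ (PiTensorProduct.tprod k f) =
      PiTensorProduct.tprod k fun i => f (σ.symm i) := by
  simp only [permAct, LinearEquiv.coe_coe]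
  exact PiTensorProduct.reindex_tprod σ f

theorem slAct_one (g : SpecialLinearGroup k U) : slAct k U L g 1 = 1 := by
  rw [PiTensorProduct.one_def, slAct_tprod]
  simp [Pi.one_def]

theorem slAct_mul (g : SpecialLinearGroup k U) (x y : Ambient k U L) :
    slAct k U L g (x * y) = slAct k U L g x * slAct k U L g y := by
  induction x using PiTensorProduct.induction_on with
  | smul_tprod r f =>
    induction y using PiTensorProduct.induction_on with
    | smul_tprod t h =>
      simp only [map_smul, smul_mul_assoc, mul_smul_comm, PiTensorProduct.tprod_mul_tprod,
        slAct_tprod, Pi.mul_apply, map_mul]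
      rfl
    | add a b ha hb => simp only [mul_add, map_add, ha, hb]
  | add a b ha hb => simp only [add_mul, map_add, ha, hb]

theorem permAct_slAct (σ : Equiv.Perm L) (g : SpecialLinearGroup k U) (x : Ambient k U L) :
    slAct k U L g (permAct k U L σ x) = permAct k U L σ (slAct k U L g x) := by
  induction x using PiTensorProduct.induction_on with
  | smul_tprod r f => simp only [map_smul, permAct_tprod, slAct_tprod]
  | add a b ha hb => simp only [map_add, ha, hb]

theorem permAct_mem_diagPiece (σ : Equiv.Perm L) (d : ℕ) {x : Ambient k U L}
    (hx : x ∈ diagPiece k U L d) : permAct k U L σ x ∈ diagPiece k U L d := by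
  refine Submodule.span_induction (p := fun y _ => permAct k U L σ y ∈ diagPiece k U L d)
    ?_ ?_ ?_ ?_ hx
  · rintro _ ⟨f, hf, rfl⟩
    rw [permAct_tprod]
    exact Submodule.subset_span ⟨_, fun i => hf _, rfl⟩
  · simp
  · intro a b _ _ ha hb
    simpa using add_mem ha hb
  · intro c a _ ha
    simpa using Submodule.smul_mem _ c ha

theorem one_mem_diagPiece : (1 : Ambient k U L) ∈ diagPiece k U L 0 :=
  Submodule.subset_span ⟨1, fun _ => by simp [symPow], rfl⟩

theorem diagPiece_mul_le (d e : ℕ) :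
    diagPiece k U L d * diagPiece k U L e ≤ diagPiece k U L (d + e) := by
  rw [diagPiece, diagPiece, Submodule.span_mul_span, Submodule.span_le]
  rintro _ ⟨_, ⟨f, hf, rfl⟩, _, ⟨h, hh, rfl⟩, rfl⟩
  refine Submodule.subset_span ⟨f * h, fun i => ?_, ?_⟩
  · rw [symPow, pow_add]
    exact Submodule.mul_mem_mul (hf i) (hh i)
  · simp

variable (k U L)

/-- The subalgebra `⨁_d (Sym^d U*)^{⊗ L}` of `Sym(U*)^{⊗ L}`. -/
def diagAlg : Subalgebra k (Ambient k U L) :=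
  Submodule.toSubalgebra (⨆ d, diagPiece k U L d)
    (Submodule.mem_iSup_of_mem 0 one_mem_diagPiece)
    (by
      intro x y hx hy
      have h : (⨆ d, diagPiece k U L d) * (⨆ d, diagPiece k U L d) ≤ ⨆ d, diagPiece k U L d := by
        rw [Submodule.iSup_mul, iSup_le_iff]
        intro d
        rw [Submodule.mul_iSup, iSup_le_iff]
        intro e
        exact (diagPiece_mul_le d e).trans (le_iSup (fun n => diagPiece k U L n) (d + e))
      exact h (Submodule.mul_mem_mul hx hy))

/-- The subalgebra of `SL(U)`-invariants of `Sym(U*)^{⊗ L}`. -/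
def slInvariants : Subalgebra k (Ambient k U L) where
  carrier := {x | ∀ g : SpecialLinearGroup k U, slAct k U L g x = x}
  mul_mem' := fun hx hy g => by rw [slAct_mul, hx g, hy g]
  add_mem' := fun hx hy g => by rw [map_add, hx g, hy g]
  algebraMap_mem' := fun r g => by
    rw [Algebra.algebraMap_eq_smul_one, map_smul, slAct_one]

/-- The ring `R_L = [⨁_d (Sym^d U*)^{⊗ L}]^{SL(U)}` of projective invariants of points on `ℙ(U)`
labelled by `L`. -/
def invRing : Subalgebra k (Ambient k U L) := diagAlg k U L ⊓ slInvariants k U L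

/-- The degree one piece `V_L = [(U*)^{⊗ L}]^{SL(U)}` of `R_L`. -/
def invDegOne : Submodule k (Ambient k U L) :=
  diagPiece k U L 1 ⊓ (slInvariants k U L).toSubmodule

theorem invDegOne_le : invDegOne k U L ≤ (invRing k U L).toSubmodule := fun _ hx =>
  ⟨le_iSup (fun d => diagPiece k U L d) 1 hx.1, hx.2⟩

/-- The inclusion of `V_L` into `R_L`. -/
def degOneIncl : invDegOne k U L →ₗ[k] invRing k U L where
  toFun x := ⟨x.1, invDegOne_le k U L x.2⟩
  map_add' _ _ := rfl
  map_smul' _ _ := rfl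

/-- The canonical map `Sym(V_L) → R_L`. -/
def symToInvRing : SymmetricAlgebra k (invDegOne k U L) →ₐ[k] invRing k U L :=
  SymmetricAlgebra.lift (degOneIncl k U L)

/-- The ideal of relations `I_L`, the kernel of `Sym(V_L) → R_L`. -/
def relIdeal : Ideal (SymmetricAlgebra k (invDegOne k U L)) :=
  RingHom.ker (symToInvRing k U L)

/-- The degree `d` piece `I_L^{(d)}` of the ideal of relations. -/
def relPiece (d : ℕ) : Submodule k (SymmetricAlgebra k (invDegOne k U L)) :=
  (relIdeal k U L).restrictScalars k ⊓ symPow k (invDegOne k U L) d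

variable {L}

/-- The action of `S_L` on `V_L`. -/
def permDegOne (σ : Equiv.Perm L) : invDegOne k U L →ₗ[k] invDegOne k U L :=
  (permAct k U L σ).restrict fun x hx =>
    ⟨permAct_mem_diagPiece σ 1 hx.1, fun g => by rw [permAct_slAct, hx.2 g]⟩

variable {k U}

/-- `s ∈ Sym(V_L)` is skew-invariant: each `σ ∈ S_L` acts on it by its sign. -/
def IsSkewInvariant [Fintype L] [DecidableEq L] (s : SymmetricAlgebra k (invDegOne k U L)) :
    Prop :=
  ∀ σ : Equiv.Perm L,
    symMap k (permDegOne k U σ) s = ((Equiv.Perm.sign σ : ℤˣ) : ℤ) • s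

end Invariants

end PointsOnLine

end

/-! Write a degree-one invariant as a multilinear polynomial `∑ c_A x_A` over subsets `A` of `L`. A
torus element and a unipotent element of `SL(U)` force `c` to live on the 4-subsets and to have zero
sum over the 4-subsets containing any given 3-subset: `c` is harmonic. Harmonic functions have
dimension `70 - 56 = 14`, and they form an irreducible representation of `S_L`, since averaging over
the stabilizer of a 4-subset always produces the same zonal function. As a non-zero invariant exists
(a product of four brackets), `V` is the whole space of harmonic functions (`degOneEquiv`).

The derivatives are relations: the coordinate `c_A` is fixed by the stabilizer of `A`, so `∂_A s` is
alternating in the four points of `A`. Its image in `R` lies in `(Sym² U*)^{⊗ L}`, and an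
alternating tensor in four factors of the 3-dimensional space `Sym² U*` vanishes.

The derivatives are independent: the `φ` with `∂_φ s = 0` form an `S_L`-stable subspace of `V*`,
which is zero or everything by irreducibility; everything is excluded by Euler's identity, as `s ≠
0`.

There are at most 14 independent quadratic relations: comparing coefficients, the Hessian `q(A, B)`
of a relation vanishes when `A` and `B` share at least three points. Harmonic functions are
invariant under complement, so it also vanishes when they share at most one. If they share exactly
two, then `A` and `B` cut `L` into four pairs, and `q` becomes a function of perfect matchings
satisfying a three-term relation. Uncrossing chords shows that such a function is determined by the
14 planar matchings of an octagon (`planarValues_injective`). The 14 derivatives therefore fill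
`I^{(2)}`. -/

open scoped TensorProduct

noncomputable section

namespace PointsOnLine

/-! ### Differential calculus on the symmetric algebra -/

section SymmetricCalculus

variable {k : Type*} [Field k] {M N : Type*} [AddCommMonoid M] [Module k M]
  [AddCommMonoid N] [Module k N]

theorem ι_mem_symPow_one (v : M) : SymmetricAlgebra.ι k M v ∈ symPow k M 1 := by
  rw [symPow, pow_one]; exact ⟨v, rfl⟩

theorem mul_mem_symPow {d e : ℕ} {p q : SymmetricAlgebra k M} (hp : p ∈ symPow k M d)
    (hq : q ∈ symPow k M e) : p * q ∈ symPow k M (d + e) := by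
  rw [symPow, pow_add]; exact Submodule.mul_mem_mul hp hq

theorem mem_symPow_zero {p : SymmetricAlgebra k M} (hp : p ∈ symPow k M 0) :
    ∃ c : k, p = algebraMap k _ c := by
  rw [symPow, pow_zero, Submodule.mem_one] at hp
  obtain ⟨c, hc⟩ := hp
  exact ⟨c, hc.symm⟩

/-- Induction on the elements `v * q` spanning a symmetric power. -/
@[elab_as_elim]
theorem symPow_succ_induction {d : ℕ} {motive : SymmetricAlgebra k M → Prop}
    (ι_mul : ∀ v q, q ∈ symPow k M d → motive (SymmetricAlgebra.ι k M v * q))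
    (add : ∀ p q, motive p → motive q → motive (p + q))
    {p : SymmetricAlgebra k M} (hp : p ∈ symPow k M (d + 1)) : motive p := by
  rw [symPow, pow_succ'] at hp
  induction hp using Submodule.mul_induction_on' with
  | mem_mul_mem m hm n hn => obtain ⟨v, rfl⟩ := hm; exact ι_mul v n hn
  | add x _ y _ hx hy => exact add x y hx hy

theorem derivation_ext {D E : Derivation k (SymmetricAlgebra k M) (SymmetricAlgebra k M)}
    (h : ∀ v, D (SymmetricAlgebra.ι k M v) = E (SymmetricAlgebra.ι k M v)) : D = E := by
  ext p
  induction p using SymmetricAlgebra.induction with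
  | algebraMap r => simp
  | ι x => exact h x
  | mul a b ha hb => simp [ha, hb]
  | add a b ha hb => simp [ha, hb]

theorem partialDeriv_add (φ ψ : Module.Dual k M) :
    partialDeriv k (φ + ψ) = partialDeriv k φ + partialDeriv k ψ :=
  derivation_ext fun v => by simp [partialDeriv_ι]

theorem partialDeriv_smul (c : k) (φ : Module.Dual k M) :
    partialDeriv k (c • φ) = c • partialDeriv k φ :=
  derivation_ext fun v => by simp [partialDeriv_ι, Algebra.smul_def]

/-- The linear map `φ ↦ ∂_φ p`. -/
def partialDerivHom (p : SymmetricAlgebra k M) : Module.Dual k M →ₗ[k] SymmetricAlgebra k M where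
  toFun φ := partialDeriv k φ p
  map_add' φ ψ := by simp [partialDeriv_add]
  map_smul' c φ := by simp [partialDeriv_smul]

@[simp] theorem partialDerivHom_apply (p : SymmetricAlgebra k M) (φ : Module.Dual k M) :
    partialDerivHom p φ = partialDeriv k φ p := rfl

theorem partialDeriv_ι_mul (φ : Module.Dual k M) (v : M) (q : SymmetricAlgebra k M) :
    partialDeriv k φ (SymmetricAlgebra.ι k M v * q) =
      SymmetricAlgebra.ι k M v * partialDeriv k φ q + φ v • q := by
  simp [partialDeriv_ι, Algebra.smul_def, mul_comm, add_comm]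

theorem partialDeriv_mem_symPow (φ : Module.Dual k M) {d : ℕ} {p : SymmetricAlgebra k M}
    (hp : p ∈ symPow k M (d + 1)) : partialDeriv k φ p ∈ symPow k M d := by
  induction d generalizing p with
  | zero =>
    refine symPow_succ_induction (fun v q hq => ?_) (fun p q hp hq => ?_) hp
    · obtain ⟨c, rfl⟩ := mem_symPow_zero hq
      rw [partialDeriv_ι_mul]
      simpa using Submodule.smul_mem _ _ hq
    · rw [map_add]; exact add_mem hp hq
  | succ d ih =>
    refine symPow_succ_induction (fun v q hq => ?_) (fun p q hp hq => ?_) hp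
    · rw [partialDeriv_ι_mul]
      refine add_mem ?_ (Submodule.smul_mem _ _ hq)
      rw [add_comm d 1]
      exact mul_mem_symPow (ι_mem_symPow_one v) (ih hq)
    · rw [map_add]; exact add_mem hp hq

/-- Euler's identity. -/
theorem sum_ι_mul_partialDeriv {κ : Type*} [Fintype κ] [DecidableEq κ] (b : Module.Basis κ k M)
    {d : ℕ} {p : SymmetricAlgebra k M} (hp : p ∈ symPow k M d) :
    ∑ i, SymmetricAlgebra.ι k M (b i) * partialDeriv k (b.coord i) p = (d : k) • p := by
  induction d generalizing p with
  | zero =>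
    obtain ⟨c, rfl⟩ := mem_symPow_zero hp
    simp
  | succ d ih =>
    refine symPow_succ_induction (fun v q hq => ?_) (fun p q hp hq => ?_) hp
    · have h1 : ∑ i, SymmetricAlgebra.ι k M (b i) * (b.coord i v • q) =
          SymmetricAlgebra.ι k M v * q := by
        conv_rhs => rw [← b.sum_repr v, map_sum, Finset.sum_mul]
        simp
      simp only [partialDeriv_ι_mul, mul_add, Finset.sum_add_distrib, h1]
      simp only [mul_left_comm _ (SymmetricAlgebra.ι k M v), ← Finset.mul_sum, ih hq]
      simp [add_smul]
    · simp only [map_add, mul_add, Finset.sum_add_distrib, hp, hq, smul_add]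

/-- Euler's identity, where the degree `d + 1` is invertible in characteristic zero. -/
theorem eq_zero_of_partialDeriv_eq_zero [CharZero k] {κ : Type*} [Fintype κ]
    (b : Module.Basis κ k M) {d : ℕ} {p : SymmetricAlgebra k M} (hp : p ∈ symPow k M (d + 1))
    (h : ∀ φ, partialDeriv k φ p = 0) : p = 0 := by
  classical
  have h1 := sum_ι_mul_partialDeriv b hp
  simp only [h, mul_zero, Finset.sum_const_zero] at h1
  exact (smul_eq_zero.1 h1.symm).resolve_left (by exact_mod_cast d.succ_ne_zero)

theorem symMap_ι (f : M →ₗ[k] N) (v : M) :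
    symMap k f (SymmetricAlgebra.ι k M v) = SymmetricAlgebra.ι k N (f v) := by
  simp [symMap]

/-- Chain rule for a linear substitution; it suffices to compare both sides on generators. -/
theorem partialDeriv_symMap (f : M →ₗ[k] N) (φ : Module.Dual k N) (p : SymmetricAlgebra k M) :
    partialDeriv k φ (symMap k f p) = symMap k f (partialDeriv k (φ ∘ₗ f) p) := by
  induction p using SymmetricAlgebra.induction with
  | algebraMap r => simp
  | ι x => simp [symMap_ι, partialDeriv_ι]
  | mul a b ha hb => simp [ha, hb]
  | add a b ha hb => simp [ha, hb]

/-- For a semi-invariant form this makes the space of directions with zero derivative stable under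
the group. -/
theorem partialDeriv_eq_zero_of_symMap_eq_smul (f : M →ₗ[k] N) (φ : Module.Dual k N)
    {p : SymmetricAlgebra k M} {q : SymmetricAlgebra k N} {c : k} (hc : c ≠ 0)
    (hpq : symMap k f p = c • q) (h : partialDeriv k (φ ∘ₗ f) p = 0) :
    partialDeriv k φ q = 0 := by
  have h1 := partialDeriv_symMap f φ p
  rw [hpq, h, map_zero, Derivation.map_smul] at h1
  exact (smul_eq_zero.1 h1).resolve_left hc

end SymmetricCalculus

/-! ### Harmonic functions on the 4-subsets of an 8-element set -/

section Harmonic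

open scoped Pointwise

variable (k : Type*) [Field k] (L : Type*) [Fintype L] [DecidableEq L]

/-- Functions on the `4`-subsets of `L`, extended by zero to all subsets, with vanishing sum over
the `4`-subsets containing any given `3`-subset. -/
def harmonic : Submodule k (Finset L → k) where
  carrier := {c | (∀ A, A.card ≠ 4 → c A = 0) ∧
    ∀ C : Finset L, C.card = 3 → ∑ x ∈ Cᶜ, c (insert x C) = 0}
  zero_mem' := by simp
  add_mem' := fun {c d} hc hd => ⟨fun A hA => by simp [hc.1 A hA, hd.1 A hA], fun C hC => by
    simp [Finset.sum_add_distrib, hc.2 C hC, hd.2 C hC]⟩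
  smul_mem' := fun r c hc => ⟨fun A hA => by simp [hc.1 A hA], fun C hC => by
    simp [← Finset.mul_sum, hc.2 C hC]⟩

variable {k L}

theorem sum_compl_split {M : Type*} [AddCommMonoid M] (f : L → M) (C D : Finset L) :
    ∑ x ∈ Dᶜ, f x = ∑ x ∈ C \ D, f x + ∑ x ∈ Dᶜ \ C, f x := by
  rw [← Finset.sum_union]
  · congr 1; ext x; simp; tauto
  · exact Finset.disjoint_left.2 fun x hx hy => by simp at hx hy; tauto

theorem card_compl_sdiff (hL : Fintype.card L = 8) (C D : Finset L) :
    (Dᶜ \ C).card + C.card + D.card = 8 + (D ∩ C).card := by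
  have h1 : Dᶜ \ C = (D ∪ C)ᶜ := by ext x; simp
  have h2 := Finset.card_union_add_card_inter D C
  have h3 := Finset.card_compl_add_card (D ∪ C)
  rw [h1]; omega

omit [Fintype L] in
theorem card_sdiff_add (C D : Finset L) : (C \ D).card + (D ∩ C).card = C.card := by
  rw [Finset.inter_comm, Finset.card_sdiff_add_card_inter]

/-- The raising operator on functions on subsets, from `4`-subsets to `3`-subsets, together with
the values outside of the `4`-subsets. -/
def lowering : (Finset L → k) →ₗ[k]
    ({A : Finset L // ¬ A.card = 4} → k) × ({C : Finset L // C.card = 3} → k) where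
  toFun c := (fun A => c A.1, fun C => ∑ x ∈ C.1ᶜ, c (insert x C.1))
  map_add' c d := by ext <;> simp [Finset.sum_add_distrib]
  map_smul' r c := by ext <;> simp [Finset.mul_sum]

theorem ker_lowering : LinearMap.ker (lowering (k := k) (L := L)) = harmonic k L := by
  ext c
  simp only [LinearMap.mem_ker, lowering, LinearMap.coe_mk, AddHom.coe_mk, Prod.mk_eq_zero,
    funext_iff, Pi.zero_apply, Subtype.forall]
  rfl

/-- Coefficients of a right inverse of the map from `4`-subsets to `3`-subsets. -/
def inverseCoeff (k : Type*) [Field k] : ℕ → k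
  | 0 => -1 / 20
  | 1 => 1 / 30
  | 2 => -1 / 20
  | _ => 1 / 5

/-- With `i = |C ∩ D|`, a point `x` outside `D` lies in `C` in `3 - i` cases and outside `C` in `2 +
i` cases. The coefficients `α` are the solution of `(3 - i) α (i + 1) + (2 + i) α i = δ_{i,3}`. -/
theorem sum_inverseCoeff [CharZero k] (hL : Fintype.card L = 8) {C D : Finset L}
    (hC : C.card = 3) (hD : D.card = 3) :
    ∑ x ∈ Dᶜ, inverseCoeff k (insert x D ∩ C).card = if C = D then 1 else 0 := by
  have h1 := card_compl_sdiff hL C D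
  have h2 := card_sdiff_add C D
  rw [sum_compl_split _ C D,
    Finset.sum_congr (g := fun _ => inverseCoeff k ((D ∩ C).card + 1)) rfl,
    Finset.sum_congr (s₁ := Dᶜ \ C) (g := fun _ => inverseCoeff k (D ∩ C).card) rfl]
  · have h3 : C = D ↔ (D ∩ C).card = 3 := by
      constructor
      · rintro rfl; simpa using hC
      · intro h
        have h4 : D ∩ C = D := Finset.eq_of_subset_of_card_le Finset.inter_subset_left (by omega)
        exact (Finset.eq_of_subset_of_card_le (h4 ▸ Finset.inter_subset_right) (by omega)).symm
    simp only [Finset.sum_const, h3, nsmul_eq_mul]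
    generalize (D ∩ C).card = i at *
    have h5 : (C \ D).card = 3 - i := by omega
    have h6 : (Dᶜ \ C).card = 2 + i := by omega
    have h7 : i ≤ 3 := by omega
    rw [h5, h6]
    interval_cases i <;> norm_num [inverseCoeff]
  · intro x hx
    simp only [Finset.mem_sdiff, Finset.mem_compl] at hx
    rw [Finset.insert_inter_of_notMem hx.2]
  · intro x hx
    simp only [Finset.mem_sdiff] at hx
    rw [Finset.insert_inter_of_mem hx.1, Finset.card_insert_of_notMem (by simp [hx.2])]

theorem lowering_surjective [CharZero k] (hL : Fintype.card L = 8) :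
    Function.Surjective (lowering (k := k) (L := L)) := by
  rintro ⟨f, g⟩
  refine ⟨fun A => if h : ¬ A.card = 4 then f ⟨A, h⟩ else
    ∑ C, g C * inverseCoeff k (A ∩ C.1).card, ?_⟩
  ext D
  · simp [lowering, D.2]
  · obtain ⟨D, hD⟩ := D
    have h : ∀ x ∈ Dᶜ, (insert x D).card = 4 := fun x hx => by
      rw [Finset.card_insert_of_notMem (by simpa using hx), hD]
    simp only [lowering, LinearMap.coe_mk, AddHom.coe_mk]
    rw [Finset.sum_congr rfl fun x hx => dif_neg (not_not.2 (h x hx)), Finset.sum_comm]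
    simp_rw [← Finset.mul_sum]
    rw [Finset.sum_congr rfl fun (C : {C : Finset L // C.card = 3}) _ => by
      rw [sum_inverseCoeff (k := k) hL C.2 hD]]
    rw [Finset.sum_eq_single ⟨D, hD⟩]
    · simp
    · rintro ⟨C, hC⟩ _ h
      rw [if_neg (by simpa using h), mul_zero]
    · simp

/-- Rank-nullity on all `2 ^ 8` values: those off the 4-subsets cancel, leaving `70 - 56`. -/
theorem finrank_harmonic [CharZero k] (hL : Fintype.card L = 8) :
    Module.finrank k (harmonic k L) = 14 := by
  have h := (lowering (k := k) (L := L)).finrank_range_add_finrank_ker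
  rw [LinearMap.range_eq_top.2 (lowering_surjective hL), ker_lowering, finrank_top,
    Module.finrank_prod, Module.finrank_fintype_fun_eq_card, Module.finrank_fintype_fun_eq_card,
    Module.finrank_fintype_fun_eq_card, Fintype.card_subtype_compl, Fintype.card_finset_len,
    Fintype.card_finset_len, Fintype.card_finset, hL] at h
  have h4 : Nat.choose 8 4 = 70 := by decide
  have h3 : Nat.choose 8 3 = 56 := by decide
  omega

/-- The permutations of `L` preserving `A`. -/
def setStab (A : Finset L) : Finset (Equiv.Perm L) := {σ | σ • A = A}

theorem mem_setStab {A : Finset L} {σ : Equiv.Perm L} : σ ∈ setStab A ↔ σ • A = A := by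
  simp [setStab]

theorem card_setStab_ne_zero [CharZero k] (A : Finset L) : ((setStab A).card : k) ≠ 0 := by
  have : (1 : Equiv.Perm L) ∈ setStab A := mem_setStab.2 (one_smul _ A)
  exact_mod_cast (Finset.card_pos.2 ⟨_, this⟩).ne'

theorem sum_setStab_mul_right {M : Type*} [AddCommMonoid M] {A : Finset L} {τ : Equiv.Perm L}
    (hτ : τ ∈ setStab A) (f : Equiv.Perm L → M) :
    ∑ σ ∈ setStab A, f (σ * τ) = ∑ σ ∈ setStab A, f σ := by
  rw [mem_setStab] at hτ
  refine Finset.sum_bij (fun σ _ => σ * τ) (fun σ hσ => ?_) (fun _ _ _ _ h => mul_right_cancel h)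
    (fun σ hσ => ⟨σ * τ⁻¹, ?_, by simp⟩) (fun _ _ => rfl)
  · rw [mem_setStab] at hσ ⊢; rw [mul_smul, hτ, hσ]
  · rw [mem_setStab] at hσ ⊢; rw [mul_smul, inv_smul_eq_iff.2 hτ.symm, hσ]

omit [Fintype L] in
theorem exists_smul_eq_of_card_eq {A B : Finset L} (h : A.card = B.card) :
    ∃ σ : Equiv.Perm L, σ • A = B := by
  obtain ⟨σ, hσ⟩ := Equiv.Perm.exists_map_finset_eq A B h
  refine ⟨σ, ?_⟩
  rw [← hσ, Finset.map_eq_image]; rfl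

theorem smul_compl_eq (σ : Equiv.Perm L) (C : Finset L) : (σ • C)ᶜ = σ • Cᶜ := by
  ext x
  rw [Finset.mem_compl, ← Finset.inv_smul_mem_iff, ← Finset.inv_smul_mem_iff, Finset.mem_compl]

theorem comp_smul_mem_harmonic (σ : Equiv.Perm L) {v : Finset L → k} (hv : v ∈ harmonic k L) :
    (fun B => v (σ • B)) ∈ harmonic k L := by
  refine ⟨fun A hA => hv.1 _ (by rwa [Finset.card_smul_finset]), fun C hC => ?_⟩
  have h := hv.2 (σ • C) (by rwa [Finset.card_smul_finset])
  rw [smul_compl_eq] at h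
  rw [← h]
  refine Finset.sum_bij (fun x _ => σ x) (fun x hx => ?_) (fun _ _ _ _ h => σ.injective h)
    (fun y hy => ?_) (fun x _ => ?_)
  · exact Finset.smul_mem_smul_finset hx
  · obtain ⟨x, hx, rfl⟩ := Finset.mem_smul_finset.1 hy
    exact ⟨x, hx, rfl⟩
  · change v (σ • insert x C) = _
    rw [Finset.smul_finset_insert]; rfl

/-- The value at `B` of the zonal harmonic function of a `4`-subset meeting `B` in `j` elements. -/
def zonalCoeff (k : Type*) [Field k] (j : ℕ) : k := (-1) ^ j / (Nat.choose 4 j : k)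

theorem swap_mem_setStab {A : Finset L} {x y : L} (hx : x ∈ A) (hy : y ∈ A) :
    Equiv.swap x y ∈ setStab A := by
  rw [mem_setStab]
  refine Finset.eq_of_subset_of_card_le ?_ (Finset.card_smul_finset _ _).ge
  intro z hz
  obtain ⟨w, hw, rfl⟩ := Finset.mem_smul_finset.1 hz
  simp only [Equiv.Perm.smul_def, Equiv.swap_apply_def]
  split_ifs <;> assumption

theorem setStab_compl (A : Finset L) : setStab Aᶜ = setStab A := by
  ext σ
  rw [mem_setStab, mem_setStab, ← smul_compl_eq, compl_inj_iff]

omit [Fintype L] in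
theorem swap_smul_insert {C : Finset L} {x y : L} (hx : x ∉ C) (hy : y ∉ C) :
    Equiv.swap x y • insert x C = insert y C := by
  rw [Finset.smul_finset_insert, Equiv.Perm.smul_def, Equiv.swap_apply_left]
  congr 1
  ext z
  rw [← Finset.inv_smul_mem_iff, Equiv.swap_inv, Equiv.Perm.smul_def, Equiv.swap_apply_def]
  split_ifs with h1 h2 <;> simp_all

/-- By invariance `u B` depends only on `j = |A ∩ B|`, say `u B = f j`. Harmonicity at a 3-subset
meeting `A` in `j` points reads `(4 - j) f (j + 1) + (1 + j) f j = 0`, and this recursion,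
descending from `f 4 = u A`, gives `(-1) ^ j / C(4, j)`. -/
theorem harmonic_eq_zonalCoeff_mul [CharZero k] (hL : Fintype.card L = 8) {u : Finset L → k}
    (hu : u ∈ harmonic k L) {A B : Finset L} (hinv : ∀ τ ∈ setStab A, ∀ D, u (τ • D) = u D)
    (hA : A.card = 4) (hB : B.card = 4) : u B = zonalCoeff k (A ∩ B).card * u A := by
  induction h : (A \ B).card generalizing B with
  | zero =>
    have hAB : A = B := Finset.eq_of_subset_of_card_le
      (Finset.sdiff_eq_empty_iff_subset.1 (Finset.card_eq_zero.1 h)) (by omega)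
    subst hAB
    norm_num [hA, zonalCoeff]
  | succ n ih =>
    have hc1 := Finset.card_sdiff_add_card_inter A B
    have hc2 := Finset.card_sdiff_add_card_inter B A
    rw [Finset.inter_comm] at hc2
    obtain ⟨x, hx⟩ := Finset.card_pos.1 (by omega : 0 < (A \ B).card)
    obtain ⟨y, hy⟩ := Finset.card_pos.1 (by omega : 0 < (B \ A).card)
    rw [Finset.mem_sdiff] at hx hy
    obtain ⟨C, hyC, rfl⟩ : ∃ C, y ∉ C ∧ insert y C = B :=
      ⟨B.erase y, Finset.notMem_erase y B, Finset.insert_erase hy.1⟩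
    have hxC : x ∉ C := fun hh => hx.2 (Finset.mem_insert_of_mem hh)
    have hC : C.card = 3 := by rw [Finset.card_insert_of_notMem hyC] at hB; omega
    have hCA : A ∩ insert y C = C ∩ A := by
      rw [Finset.inter_insert_of_notMem hy.2, Finset.inter_comm]
    have hsum := hu.2 C hC
    -- Transpositions of two points of `A`, or of two points of its complement, preserve `A`; so the
    -- harmonic sum takes only two different values.
    have e1 : ∀ z ∈ A \ C, u (insert z C) = u (insert x C) := fun z hz => by
      rw [Finset.mem_sdiff] at hz
      rw [← swap_smul_insert hxC hz.2, hinv _ (swap_mem_setStab hx.1 hz.1)]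
    have e2 : ∀ z ∈ Cᶜ \ A, u (insert z C) = u (insert y C) := fun z hz => by
      rw [Finset.mem_sdiff, Finset.mem_compl] at hz
      rw [← swap_smul_insert hyC hz.1, hinv]
      rw [← setStab_compl]
      exact swap_mem_setStab (by simpa using hy.2) (by simpa using hz.2)
    rw [sum_compl_split _ A C, Finset.sum_congr rfl e1, Finset.sum_congr rfl e2] at hsum
    have hc3 := card_compl_sdiff hL A C
    have hc4 := card_sdiff_add A C
    have hAi : (A ∩ insert x C).card = (C ∩ A).card + 1 := by
      rw [Finset.inter_insert_of_mem hx.1, Finset.card_insert_of_notMem (by simp [hxC]),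
        Finset.inter_comm]
    have ih' := ih (B := insert x C) (by rw [Finset.card_insert_of_notMem hxC, hC]) (by
      have := Finset.card_sdiff_add_card_inter A (insert x C); rw [hCA] at hc1; omega)
    rw [hAi] at ih'
    rw [ih', Finset.sum_const, Finset.sum_const, nsmul_eq_mul, nsmul_eq_mul] at hsum
    rw [hCA]
    generalize (C ∩ A).card = j at *
    have h5 : (A \ C).card = 4 - j := by omega
    have h6 : (Cᶜ \ A).card = 1 + j := by omega
    have h7 : j < 4 := by
      have := Finset.card_pos.2 ⟨x, Finset.mem_sdiff.2 ⟨hx.1, hxC⟩⟩; omega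
    rw [h5, h6] at hsum
    clear * - hsum h7
    generalize u (insert y C) = p at *
    generalize u A = q at *
    interval_cases j <;> norm_num [zonalCoeff, Nat.choose] at hsum ⊢
    · linear_combination hsum
    · linear_combination hsum / 2
    · linear_combination hsum / 3
    · linear_combination hsum / 4

/-- The sum over the stabilizer of `A` is harmonic and invariant, so it is determined by its value
at `A`, where all terms equal `v A`. -/
theorem sum_setStab_harmonic [CharZero k] (hL : Fintype.card L = 8) {v : Finset L → k}
    (hv : v ∈ harmonic k L) {A B : Finset L} (hA : A.card = 4) (hB : B.card = 4) :
    ∑ σ ∈ setStab A, v (σ • B) = (setStab A).card * zonalCoeff k (A ∩ B).card * v A := by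
  have hmem : (∑ σ ∈ setStab A, fun D => v (σ • D)) ∈ harmonic k L :=
    Submodule.sum_mem _ fun σ _ => comp_smul_mem_harmonic σ hv
  have h := harmonic_eq_zonalCoeff_mul hL hmem (A := A) (B := B) (fun τ hτ D => by
    simpa only [Finset.sum_apply, smul_smul] using
      sum_setStab_mul_right hτ fun σ => v (σ • D)) hA hB
  have h1 : ∑ σ ∈ setStab A, v (σ • A) = (setStab A).card * v A := by
    rw [Finset.sum_congr rfl fun σ hσ => by rw [mem_setStab.1 hσ]]
    simp
  rw [Finset.sum_apply, Finset.sum_apply, h1] at h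
  rw [h]; ring

/-- Harmonic functions on `4`-subsets of an `8`-element set are invariant under complement. -/
theorem harmonic_compl [CharZero k] (hL : Fintype.card L = 8) {v : Finset L → k}
    (hv : v ∈ harmonic k L) (A : Finset L) : v Aᶜ = v A := by
  have hc := Finset.card_compl_add_card A
  by_cases hA : A.card = 4
  -- The stabilizer of `A` also fixes `Aᶜ`, so every term is `v Aᶜ`, while `zonalCoeff k 0 = 1`.
  · have h := sum_setStab_harmonic hL hv hA (B := Aᶜ) (by omega)
    rw [Finset.sum_congr rfl fun σ hσ => by
      rw [← smul_compl_eq, mem_setStab.1 hσ]] at h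
    have h0 := card_setStab_ne_zero (k := k) A
    simp [zonalCoeff] at h
    exact h.resolve_right (by simpa using h0)
  · rw [hv.1 A hA, hv.1 Aᶜ (by omega)]

/-- The zonal harmonic function of `A`. -/
def zonal (k : Type*) [Field k] (A : Finset L) : Finset L → k :=
  fun B => if B.card = 4 then zonalCoeff k (A ∩ B).card else 0

omit [Fintype L] in
theorem zonal_smul (σ : Equiv.Perm L) (A B : Finset L) :
    zonal k (σ • A) (σ • B) = zonal k A B := by
  rw [zonal, zonal, ← Finset.smul_finset_inter, Finset.card_smul_finset, Finset.card_smul_finset]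

theorem sum_setStab_eq_smul_zonal [CharZero k] (hL : Fintype.card L = 8) {v : Finset L → k}
    (hv : v ∈ harmonic k L) {A : Finset L} (hA : A.card = 4) :
    (∑ σ ∈ setStab A, fun B => v (σ • B)) = ((setStab A).card * v A : k) • zonal k A := by
  ext B
  rw [Finset.sum_apply, Pi.smul_apply, smul_eq_mul, zonal]
  split_ifs with hB
  · rw [sum_setStab_harmonic hL hv hA hB]; ring
  · rw [mul_zero]
    exact Finset.sum_eq_zero fun σ _ => hv.1 _ (by rwa [Finset.card_smul_finset])

/-- The squared norm of a zonal harmonic function. -/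
def zonalNorm (k : Type*) [Field k] (A : Finset L) : k :=
  ∑ B : Finset L with B.card = 4, zonalCoeff k (A ∩ B).card ^ 2

theorem zonalNorm_smul (σ : Equiv.Perm L) (A : Finset L) :
    zonalNorm k (σ • A) = zonalNorm k A := by
  refine (Finset.sum_bij (fun B _ => σ • B) (fun B hB => ?_)
    (fun _ _ _ _ h => smul_left_cancel σ h) (fun B hB => ⟨σ⁻¹ • B, ?_, by simp⟩)
    (fun B _ => ?_)).symm
  · simpa using hB
  · simpa using hB
  · rw [← Finset.smul_finset_inter, Finset.card_smul_finset]

/-- The norm comes from `ℚ`, where it is a sum of squares with a positive term at `B = A`. -/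
theorem zonalNorm_ne_zero [CharZero k] {A : Finset L} (hA : A.card = 4) :
    zonalNorm k A ≠ 0 := by
  have h : zonalNorm k A = ((zonalNorm ℚ A : ℚ) : k) := by
    simp [zonalNorm, zonalCoeff]
  rw [h, Rat.cast_ne_zero]
  refine (Finset.sum_pos' (fun _ _ => sq_nonneg _) ⟨A, by simpa using hA, ?_⟩).ne'
  norm_num [zonalCoeff, hA]

/-- Reproducing property of zonal functions. The left side is unchanged when `v` is moved by the
stabilizer of `B`; averaging replaces `v` by `v B` times the zonal function of `B`, and the sum
becomes a sum of squares. -/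
theorem sum_smul_zonal [CharZero k] (hL : Fintype.card L = 8) {v : Finset L → k}
    (hv : v ∈ harmonic k L) {B : Finset L} (hB : B.card = 4) :
    ∑ A : Finset L with A.card = 4, v A * zonal k A B = zonalNorm k B * v B := by
  have h0 := card_setStab_ne_zero (k := k) B
  refine mul_left_cancel₀ h0 ?_
  have h1 : ∀ σ ∈ setStab B, ∑ A : Finset L with A.card = 4, v (σ • A) * zonal k A B =
      ∑ A : Finset L with A.card = 4, v A * zonal k A B := by
    intro σ hσ
    refine Finset.sum_bij (fun A _ => σ • A) (fun A hA => ?_)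
      (fun _ _ _ _ h => smul_left_cancel σ h) (fun A hA => ⟨σ⁻¹ • A, ?_, by simp⟩)
      (fun A _ => ?_)
    · simpa using hA
    · simpa using hA
    · have h2 : zonal k (σ • A) B = zonal k A B := by
        conv_lhs => rw [← mem_setStab.1 hσ, zonal_smul]
      rw [h2]
  rw [← nsmul_eq_mul, ← Finset.sum_const, ← Finset.sum_congr rfl h1, Finset.sum_comm, zonalNorm,
    Finset.sum_mul, Finset.mul_sum]
  refine Finset.sum_congr rfl fun A hA => ?_
  rw [← Finset.sum_mul, sum_setStab_harmonic hL hv hB (by simpa using hA), zonal, if_pos hB,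
    Finset.inter_comm A B]
  ring

/-- If `v A ≠ 0` for some `v ∈ N`, averaging `v` over the stabilizer of `A` puts the zonal function
of `A` in `N`. Its translates are all zonal functions, and these span by the reproducing property.
-/
theorem harmonic_irreducible [CharZero k] (hL : Fintype.card L = 8)
    {N : Submodule k (Finset L → k)} (hN : N ≤ harmonic k L)
    (hinv : ∀ (σ : Equiv.Perm L), ∀ v ∈ N, (fun B => v (σ • B)) ∈ N) (h0 : N ≠ ⊥) :
    N = harmonic k L := by
  obtain ⟨v, hv, hv0⟩ := Submodule.exists_mem_ne_zero_of_ne_bot h0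
  obtain ⟨A, hA0⟩ := Function.ne_iff.1 hv0
  have hA : A.card = 4 := by
    by_contra h; exact hA0 ((hN hv).1 A h)
  have hzA : zonal k A ∈ N := by
    have h1 : (∑ σ ∈ setStab A, fun B => v (σ • B)) ∈ N :=
      Submodule.sum_mem _ fun σ _ => hinv σ v hv
    rw [sum_setStab_eq_smul_zonal hL (hN hv) hA] at h1
    exact (Submodule.smul_mem_iff _ (mul_ne_zero (card_setStab_ne_zero A) hA0)).1 h1
  have hz : ∀ B : Finset L, B.card = 4 → zonal k B ∈ N := by
    intro B hB
    obtain ⟨σ, rfl⟩ := exists_smul_eq_of_card_eq (hB.trans hA.symm)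
    convert hinv σ _ hzA using 1
    ext D
    rw [zonal_smul]
  refine le_antisymm hN fun w hw => ?_
  have h1 : (∑ B : Finset L with B.card = 4, w B • zonal k B) ∈ N :=
    Submodule.sum_mem _ fun B hB => Submodule.smul_mem _ _ (hz B (by simpa using hB))
  have h2 : (∑ B : Finset L with B.card = 4, w B • zonal k B) = zonalNorm k A • w := by
    ext D
    simp only [Finset.sum_apply, Pi.smul_apply, smul_eq_mul]
    by_cases hD : D.card = 4
    · rw [sum_smul_zonal hL hw hD]
      obtain ⟨σ, rfl⟩ := exists_smul_eq_of_card_eq (hA.trans hD.symm)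
      rw [zonalNorm_smul]
    · rw [hw.1 D hD, mul_zero]
      exact Finset.sum_eq_zero fun B _ => by rw [zonal, if_neg hD, mul_zero]
  rw [h2] at h1
  exact (Submodule.smul_mem_iff _ (zonalNorm_ne_zero hA)).1 h1

end Harmonic

/-! ### Multilinear coordinates and the conditions imposed by torus and unipotent elements -/

section Coordinates

open scoped Pointwise

variable {k : Type*} [Field k] {U : Type*} [AddCommGroup U] [Module k U]
  {L : Type*} [Fintype L] [DecidableEq L]

/-- The exponent vector of the squarefree monomial of `A`. -/
def setExp (A : Finset L) : L →₀ ℕ := ∑ i ∈ A, Finsupp.single i 1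

omit [Fintype L] in
theorem setExp_apply (A : Finset L) (i : L) : setExp A i = if i ∈ A then 1 else 0 := by
  simp [setExp, Finsupp.finsetSum_apply, Finsupp.single_apply]

omit [Fintype L] in
theorem setExp_injective : Function.Injective (setExp (L := L)) := fun A B h => by
  ext i
  have := DFunLike.congr_fun h i
  simp only [setExp_apply] at this
  grind

omit [Fintype L] [DecidableEq L] in
theorem prod_X_eq_monomial (A : Finset L) :
    ∏ i ∈ A, (MvPolynomial.X i : MvPolynomial L k) = MvPolynomial.monomial (setExp A) 1 := by
  rw [setExp, MvPolynomial.monomial_sum_one]; rfl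

omit [Fintype L] in
theorem coeff_setExp_prod_X (A B : Finset L) :
    MvPolynomial.coeff (setExp B) (∏ i ∈ A, (MvPolynomial.X i : MvPolynomial L k)) =
      if A = B then 1 else 0 := by
  rw [prod_X_eq_monomial, MvPolynomial.coeff_monomial]
  simp only [setExp_injective.eq_iff]

variable (b : Module.Basis (Fin 2) k U)

/-- Dehomogenization of the `i`-th tensor factor, sending the first coordinate function to the
variable of index `i` and the second one to `1`. -/
def dehomFactor (i : L) : SymmetricAlgebra k (Module.Dual k U) →ₐ[k] MvPolynomial L k :=
  SymmetricAlgebra.lift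
    ((Module.Dual.eval k U (b 0)).smulRight (MvPolynomial.X i) +
      (Module.Dual.eval k U (b 1)).smulRight 1)

omit [Fintype L] [DecidableEq L] in
theorem dehomFactor_ι (i : L) (φ : Module.Dual k U) :
    dehomFactor b i (SymmetricAlgebra.ι k _ φ) =
      φ (b 0) • MvPolynomial.X i + φ (b 1) • (1 : MvPolynomial L k) := by
  simp [dehomFactor]

/-- Dehomogenization of `Sym(U*)^{⊗ L}`. -/
def dehom : Ambient k U L →ₐ[k] MvPolynomial L k :=
  PiTensorProduct.liftAlgHom
    ((MultilinearMap.mkPiAlgebra k L (MvPolynomial L k)).compLinearMap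
      fun i => (dehomFactor b i).toLinearMap)
    (by simp) (fun x y => by simp [Finset.prod_mul_distrib])

omit [DecidableEq L] in
theorem dehom_tprod (f : L → SymmetricAlgebra k (Module.Dual k U)) :
    dehom b (PiTensorProduct.tprod k f) = ∏ i, dehomFactor b i (f i) := by
  exact PiTensorProduct.lift.tprod f

/-- The multilinear monomial with the first coordinate function in the factors in `A` and the
second one in the others. -/
def multiMon (A : Finset L) : Ambient k U L :=
  PiTensorProduct.tprod k fun i =>
    SymmetricAlgebra.ι k _ (if i ∈ A then b.coord 0 else b.coord 1)

theorem dehom_multiMon (A : Finset L) :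
    dehom b (multiMon b A) = ∏ i ∈ A, MvPolynomial.X i := by
  rw [multiMon, dehom_tprod, Finset.prod_congr rfl (g := fun i => if i ∈ A then
    MvPolynomial.X i else 1), Finset.prod_ite_mem, Finset.univ_inter]
  intro i _
  rw [dehomFactor_ι]
  split_ifs <;> simp

omit [Fintype L] in
theorem permAct_multiMon (σ : Equiv.Perm L) (A : Finset L) :
    permAct k U L σ (multiMon b A) = multiMon b (σ • A) := by
  rw [multiMon, permAct_tprod, multiMon]
  simp only [← Finset.inv_smul_mem_iff]
  rfl

/-- The multilinear polynomial with given coefficients. -/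
def ofCoeffs : (Finset L → k) →ₗ[k] Ambient k U L := Fintype.linearCombination k (multiMon b)

theorem ofCoeffs_apply (c : Finset L → k) : ofCoeffs b c = ∑ A, c A • multiMon b A := by
  simp [ofCoeffs, Fintype.linearCombination_apply]

/-- The coefficient of the multilinear monomial of `A`. -/
def multiCoeff (A : Finset L) : Ambient k U L →ₗ[k] k :=
  MvPolynomial.lcoeff k (setExp A) ∘ₗ (dehom b).toLinearMap

omit [DecidableEq L] in
theorem multiCoeff_apply (A : Finset L) (x : Ambient k U L) :
    multiCoeff b A x = MvPolynomial.coeff (setExp A) (dehom b x) := rfl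

theorem multiCoeff_multiMon (A B : Finset L) :
    multiCoeff b B (multiMon b A) = if A = B then 1 else 0 := by
  rw [multiCoeff_apply, dehom_multiMon, coeff_setExp_prod_X]

theorem multiCoeff_ofCoeffs (c : Finset L → k) (A : Finset L) :
    multiCoeff b A (ofCoeffs b c) = c A := by
  simp [ofCoeffs_apply, multiCoeff_multiMon]

theorem eq_coord_add_coord (φ : Module.Dual k U) :
    φ = φ (b 0) • b.coord 0 + φ (b 1) • b.coord 1 := by
  refine b.ext fun i => ?_
  fin_cases i <;> simp

omit [Fintype L] in
theorem multiMon_mem_diagPiece (A : Finset L) : multiMon b A ∈ diagPiece k U L 1 :=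
  Submodule.subset_span ⟨_, fun _ => ι_mem_symPow_one _, rfl⟩

theorem ofCoeffs_mem_diagPiece (c : Finset L → k) : ofCoeffs b c ∈ diagPiece k U L 1 := by
  rw [ofCoeffs_apply]
  exact Submodule.sum_mem _ fun A _ => Submodule.smul_mem _ _ (multiMon_mem_diagPiece b A)

theorem range_ofCoeffs : LinearMap.range (ofCoeffs (L := L) b) = diagPiece k U L 1 := by
  refine le_antisymm ?_ ?_
  · rintro _ ⟨c, rfl⟩
    exact ofCoeffs_mem_diagPiece b c
  · rw [diagPiece, Submodule.span_le]
    rintro _ ⟨f, hf, rfl⟩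
    simp only [symPow, pow_one, LinearMap.mem_range] at hf
    choose φ hφ using hf
    have h1 : f = (fun i => φ i (b 0) • SymmetricAlgebra.ι k _ (b.coord 0)) +
        fun i => φ i (b 1) • SymmetricAlgebra.ι k _ (b.coord 1) := by
      funext i
      rw [← hφ i]
      conv_lhs => rw [eq_coord_add_coord b (φ i)]
      simp
    rw [h1, MultilinearMap.map_add_univ]
    refine Submodule.sum_mem _ fun A _ => ?_
    have h2 : A.piecewise (fun i => φ i (b 0) • SymmetricAlgebra.ι k _ (b.coord 0))
        (fun i => φ i (b 1) • SymmetricAlgebra.ι k _ (b.coord 1)) = fun i =>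
        (if i ∈ A then φ i (b 0) else φ i (b 1)) •
          SymmetricAlgebra.ι k _ (if i ∈ A then b.coord 0 else b.coord 1) := by
      funext i
      by_cases hi : i ∈ A <;> simp [hi]
    rw [h2, MultilinearMap.map_smul_univ]
    refine Submodule.smul_mem _ _ ⟨Pi.single A 1, ?_⟩
    simp [ofCoeffs, multiMon]

theorem eq_ofCoeffs {x : Ambient k U L} (hx : x ∈ diagPiece k U L 1) :
    x = ofCoeffs b fun A => multiCoeff b A x := by
  rw [← range_ofCoeffs b] at hx
  obtain ⟨c, rfl⟩ := hx
  simp only [multiCoeff_ofCoeffs]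

theorem permAct_ofCoeffs (σ : Equiv.Perm L) (c : Finset L → k) :
    permAct k U L σ (ofCoeffs b c) = ofCoeffs b fun A => c (σ⁻¹ • A) := by
  rw [ofCoeffs_apply, ofCoeffs_apply, map_sum]
  refine Finset.sum_bij (fun A _ => σ • A) (fun _ _ => Finset.mem_univ _)
    (fun _ _ _ _ h => smul_left_cancel σ h) (fun A _ => ⟨σ⁻¹ • A, Finset.mem_univ _, by simp⟩)
    (fun A _ => ?_)
  rw [map_smul, permAct_multiMon, inv_smul_smul]

theorem exists_slDual_coord (M : Matrix.SpecialLinearGroup (Fin 2) k) :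
    ∃ g : SpecialLinearGroup k U, ∀ i,
      slDual k U g (b.coord i) = M.1 i 0 • b.coord 0 + M.1 i 1 • b.coord 1 := by
  -- The inverse compensates for the `g⁻¹` in the contragredient action.
  refine ⟨(Matrix.SpecialLinearGroup.toLin_equiv b M)⁻¹, fun i => b.ext fun j => ?_⟩
  rw [slDual, inv_inv]
  change b.coord i (Matrix.toLin b b M.1 (b j)) = _
  rw [Matrix.toLin_self]
  fin_cases i <;> fin_cases j <;> simp

theorem dehom_slAct_multiMon (M : Matrix.SpecialLinearGroup (Fin 2) k)
    {g : SpecialLinearGroup k U}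
    (hg : ∀ i, slDual k U g (b.coord i) = M.1 i 0 • b.coord 0 + M.1 i 1 • b.coord 1)
    (A : Finset L) :
    dehom b (slAct k U L g (multiMon b A)) =
      (∏ i ∈ A, (M.1 0 0 • MvPolynomial.X i + M.1 0 1 • 1)) *
        ∏ i ∈ Aᶜ, (M.1 1 0 • MvPolynomial.X i + M.1 1 1 • 1) := by
  rw [multiMon, slAct_tprod, dehom_tprod, ← Finset.prod_mul_prod_compl A]
  congr 1
  · refine Finset.prod_congr rfl fun i hi => ?_
    rw [symMap_ι, dehomFactor_ι, if_pos hi, hg]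
    simp
  · refine Finset.prod_congr rfl fun i hi => ?_
    rw [symMap_ι, dehomFactor_ι, if_neg (Finset.mem_compl.1 hi), hg]
    simp

/-- The torus element `diag(2, 1/2)` scales the monomial of `A` by `2 ^ |A| / 2 ^ (8 - |A|)`, which
is `1` only for `|A| = 4`. -/
theorem coeff_card_eq_four [CharZero k] (hL : Fintype.card L = 8) {c : Finset L → k}
    (hc : ofCoeffs b c ∈ slInvariants k U L) {A : Finset L} (hA : A.card ≠ 4) : c A = 0 := by
  let M : Matrix.SpecialLinearGroup (Fin 2) k := ⟨!![2, 0; 0, 1 / 2], by simp⟩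
  obtain ⟨g, hg⟩ := exists_slDual_coord b M
  have h := congrArg (multiCoeff b A) (hc g)
  rw [multiCoeff_ofCoeffs, ofCoeffs_apply, map_sum, map_sum] at h
  have h1 : ∀ B : Finset L, multiCoeff b A (slAct k U L g (multiMon b B)) =
      (2 ^ B.card * (1 / 2) ^ (8 - B.card)) * if B = A then 1 else 0 := fun B => by
    rw [multiCoeff_apply, dehom_slAct_multiMon b M hg]
    simp only [M, Matrix.of_apply, Matrix.cons_val', Matrix.cons_val_zero, Matrix.cons_val_one,
      zero_smul, add_zero, zero_add, Finset.prod_smul, Finset.prod_const_one]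
    simp only [Finset.prod_const, Finset.card_compl, hL]
    simp [coeff_setExp_prod_X, MvPolynomial.coeff_smul, mul_comm]
  simp only [map_smul, h1, smul_eq_mul, mul_ite, mul_one, mul_zero, Finset.sum_ite_eq',
    Finset.mem_univ, if_true] at h
  by_contra h0
  have h2 : (2 : k) ^ A.card * (1 / 2) ^ (8 - A.card) = 1 := by
    refine mul_left_cancel₀ h0 ?_
    rw [h, mul_one]
  have hle : A.card ≤ 8 := hL ▸ Finset.card_le_univ A
  rw [one_div, inv_pow, ← div_eq_mul_inv, div_eq_one_iff_eq (by simp)] at h2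
  have h3 : 2 ^ A.card = 2 ^ (8 - A.card) := by exact_mod_cast h2
  have := Nat.pow_right_injective le_rfl h3
  omega

/-- After dehomogenization the unipotent element is the translation `X i ↦ X i + 1`. It turns the
coefficient of `C` into the sum of `c B` over all `B ⊇ C`, in which only the 4-subsets survive; `c
C` itself is zero. -/
theorem coeff_sum_eq_zero [CharZero k] (hL : Fintype.card L = 8) {c : Finset L → k}
    (hc : ofCoeffs b c ∈ slInvariants k U L) {C : Finset L} (hC : C.card = 3) :
    ∑ x ∈ Cᶜ, c (insert x C) = 0 := by
  let M : Matrix.SpecialLinearGroup (Fin 2) k := ⟨!![1, 1; 0, 1], by simp⟩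
  obtain ⟨g, hg⟩ := exists_slDual_coord b M
  have h := congrArg (multiCoeff b C) (hc g)
  rw [multiCoeff_ofCoeffs, ofCoeffs_apply, map_sum, map_sum] at h
  have h1 : ∀ B : Finset L, multiCoeff b C (slAct k U L g (multiMon b B)) =
      if C ⊆ B then 1 else 0 := fun B => by
    rw [multiCoeff_apply, dehom_slAct_multiMon b M hg]
    simp [M, Finset.prod_add_one, MvPolynomial.coeff_sum, coeff_setExp_prod_X]
  simp only [map_smul, h1, smul_eq_mul, mul_ite, mul_one, mul_zero] at h
  rw [coeff_card_eq_four b hL hc (A := C) (by omega), ← Finset.sum_filter] at h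
  rw [← h]
  refine (Finset.sum_of_injOn (fun x => insert x C) ?_ ?_ ?_ fun _ _ => rfl)
  · intro x hx y hy hxy
    simp only [Finset.coe_compl, Set.mem_compl_iff, Finset.mem_coe] at hx hy
    have hxy' : insert x C = insert y C := hxy
    have : x ∈ insert y C := hxy' ▸ Finset.mem_insert_self x C
    simpa [hx] using this
  · intro x _
    simp
  · intro B hB hB'
    refine coeff_card_eq_four b hL hc fun h4 => hB' ?_
    simp only [Finset.mem_filter, Finset.mem_univ, true_and] at hB
    have h5 : (B \ C).card = 1 := by rw [Finset.card_sdiff_of_subset hB]; omega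
    obtain ⟨x, hx⟩ := Finset.card_eq_one.1 h5
    have hx' : x ∈ B \ C := hx ▸ Finset.mem_singleton_self x
    refine ⟨x, by simpa using (Finset.mem_sdiff.1 hx').2, ?_⟩
    change insert x C = B
    rw [Finset.insert_eq, ← hx, Finset.sdiff_union_of_subset hB]

theorem mem_harmonic_of_ofCoeffs_mem [CharZero k] (hL : Fintype.card L = 8) {c : Finset L → k}
    (hc : ofCoeffs b c ∈ slInvariants k U L) : c ∈ harmonic k L :=
  ⟨fun _ hA => coeff_card_eq_four b hL hc hA, fun _ hC => coeff_sum_eq_zero b hL hc hC⟩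

end Coordinates

/-! ### Brackets, and degree-one invariants as harmonic functions -/

section DegreeOne

open scoped Pointwise

variable {k : Type*} [Field k] {U : Type*} [AddCommGroup U] [Module k U]
  {L : Type*} [DecidableEq L]

/-- The tensors that are of degree one in the factors in `S` and constant in the others. -/
def multilinearPiece (k : Type*) [Field k] (U : Type*) [AddCommGroup U] [Module k U]
    (S : Finset L) : Submodule k (Ambient k U L) :=
  Submodule.span k {x | ∃ f : L → SymmetricAlgebra k (Module.Dual k U),
    (∀ i ∈ S, f i ∈ symPow k (Module.Dual k U) 1) ∧ (∀ i ∉ S, f i = 1) ∧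
      x = PiTensorProduct.tprod k f}

theorem mul_mem_multilinearPiece {S T : Finset L} (h : Disjoint S T) {x y : Ambient k U L}
    (hx : x ∈ multilinearPiece k U S) (hy : y ∈ multilinearPiece k U T) :
    x * y ∈ multilinearPiece k U (S ∪ T) := by
  have hmul : multilinearPiece k U S * multilinearPiece k U T ≤ multilinearPiece k U (S ∪ T) := by
    rw [multilinearPiece, multilinearPiece, Submodule.span_mul_span, Submodule.span_le]
    rintro _ ⟨_, ⟨f, hf, hf1, rfl⟩, _, ⟨g, hg, hg1, rfl⟩, rfl⟩
    refine Submodule.subset_span ⟨f * g, fun i hi => ?_, fun i hi => ?_, by simp⟩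
    · rcases Finset.mem_union.1 hi with hi | hi
      · rw [Pi.mul_apply, hg1 i (Finset.disjoint_left.1 h hi), mul_one]; exact hf i hi
      · rw [Pi.mul_apply, hf1 i (Finset.disjoint_right.1 h hi), one_mul]; exact hg i hi
    · rw [Finset.mem_union, not_or] at hi
      rw [Pi.mul_apply, hf1 i hi.1, hg1 i hi.2, one_mul]
  exact hmul (Submodule.mul_mem_mul hx hy)

theorem prod_mem_multilinearPiece {κ : Type*} [DecidableEq κ] {S : κ → Finset L}
    (hS : ∀ m n, m ≠ n → Disjoint (S m) (S n)) {x : κ → Ambient k U L}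
    (hx : ∀ m, x m ∈ multilinearPiece k U (S m)) (s : Finset κ) :
    ∏ m ∈ s, x m ∈ multilinearPiece k U (s.biUnion S) := by
  induction s using Finset.induction_on with
  | empty => exact Submodule.subset_span ⟨1, by simp, by simp, by simp [PiTensorProduct.one_def]⟩
  | insert m s hm ih =>
    rw [Finset.prod_insert hm, Finset.biUnion_insert]
    refine mul_mem_multilinearPiece ?_ (hx m) ih
    rw [Finset.disjoint_biUnion_right]
    exact fun n hn => hS m n fun h => hm (h ▸ hn)

omit [DecidableEq L] in
theorem multilinearPiece_univ [Fintype L] :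
    multilinearPiece k U (Finset.univ : Finset L) = diagPiece k U L 1 := by
  simp [multilinearPiece, diagPiece]

theorem singleAlgHom_mem_multilinearPiece (i : L) (φ : Module.Dual k U) :
    (PiTensorProduct.singleAlgHom i (SymmetricAlgebra.ι k _ φ) : Ambient k U L) ∈
      multilinearPiece k U {i} := by
  refine Submodule.subset_span ⟨Pi.mulSingle i (SymmetricAlgebra.ι k _ φ), fun j hj => ?_,
    fun j hj => ?_, rfl⟩
  · rw [Finset.mem_singleton.1 hj, Pi.mulSingle_eq_same]
    exact ι_mem_symPow_one φ
  · rw [Finset.mem_singleton] at hj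
    exact Pi.mulSingle_eq_of_ne hj _

theorem slAct_singleAlgHom (g : SpecialLinearGroup k U) (i : L)
    (p : SymmetricAlgebra k (Module.Dual k U)) :
    slAct k U L g (PiTensorProduct.singleAlgHom i p) =
      PiTensorProduct.singleAlgHom i (symMap k (slDual k U g) p) := by
  simp only [PiTensorProduct.singleAlgHom_apply, slAct_tprod]
  congr 1
  funext j
  by_cases h : j = i
  · subst h; simp
  · simp [h]

variable (b : Module.Basis (Fin 2) k U)

theorem slDual_coord (g : SpecialLinearGroup k U) : ∃ N : Matrix (Fin 2) (Fin 2) k, N.det = 1 ∧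
    ∀ i, slDual k U g (b.coord i) = N i 0 • b.coord 0 + N i 1 • b.coord 1 := by
  refine ⟨LinearMap.toMatrix b b ((g⁻¹ : SpecialLinearGroup k U) : U →ₗ[k] U), ?_, fun i => ?_⟩
  · rw [LinearMap.det_toMatrix]
    exact SpecialLinearGroup.det_eq_one _
  · conv_lhs => rw [eq_coord_add_coord b (slDual k U g (b.coord i))]
    rw [LinearMap.toMatrix_apply, LinearMap.toMatrix_apply]
    rfl

/-- The `2 × 2` minor of the coordinates of the points labelled `i` and `j`. -/
def bracket (i j : L) : Ambient k U L :=
  PiTensorProduct.singleAlgHom i (SymmetricAlgebra.ι k _ (b.coord 0)) *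
      PiTensorProduct.singleAlgHom j (SymmetricAlgebra.ι k _ (b.coord 1)) -
    PiTensorProduct.singleAlgHom i (SymmetricAlgebra.ι k _ (b.coord 1)) *
      PiTensorProduct.singleAlgHom j (SymmetricAlgebra.ι k _ (b.coord 0))

theorem bracket_mem_multilinearPiece {i j : L} (h : i ≠ j) :
    bracket b i j ∈ multilinearPiece k U {i, j} := by
  have hd : Disjoint ({i} : Finset L) {j} := by simpa using h
  exact sub_mem
    (mul_mem_multilinearPiece hd (singleAlgHom_mem_multilinearPiece _ _)
      (singleAlgHom_mem_multilinearPiece _ _))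
    (mul_mem_multilinearPiece hd (singleAlgHom_mem_multilinearPiece _ _)
      (singleAlgHom_mem_multilinearPiece _ _))

theorem bracket_mem_slInvariants (i j : L) : bracket b i j ∈ slInvariants k U L := by
  intro g
  obtain ⟨N, hN, h⟩ := slDual_coord b g
  rw [Matrix.det_fin_two] at hN
  rw [bracket, map_sub, slAct_mul, slAct_mul]
  simp only [slAct_singleAlgHom, symMap_ι, h, map_add, map_smul]
  generalize (PiTensorProduct.singleAlgHom i (SymmetricAlgebra.ι k _ (b.coord 0)) :
    Ambient k U L) = p
  generalize (PiTensorProduct.singleAlgHom i (SymmetricAlgebra.ι k _ (b.coord 1)) :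
    Ambient k U L) = q
  generalize (PiTensorProduct.singleAlgHom j (SymmetricAlgebra.ι k _ (b.coord 0)) :
    Ambient k U L) = r
  generalize (PiTensorProduct.singleAlgHom j (SymmetricAlgebra.ι k _ (b.coord 1)) :
    Ambient k U L) = s
  have h1 := congrArg (algebraMap k (Ambient k U L)) hN
  simp only [map_sub, map_mul, map_one] at h1
  simp only [Algebra.smul_def]
  linear_combination (p * s - q * r) * h1

variable [Fintype L]

theorem dehom_singleAlgHom (i : L) (p : SymmetricAlgebra k (Module.Dual k U)) :
    dehom b (PiTensorProduct.singleAlgHom i p : Ambient k U L) = dehomFactor b i p := by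
  rw [PiTensorProduct.singleAlgHom_apply, dehom_tprod, Finset.prod_eq_single i]
  · simp
  · intro j _ hj; simp [hj]
  · simp

theorem dehom_bracket (i j : L) :
    dehom b (bracket b i j) = MvPolynomial.X i - MvPolynomial.X j := by
  rw [bracket, map_sub, map_mul, map_mul]
  simp only [dehom_singleAlgHom, dehomFactor_ι]
  simp

include b in
-- The product of four brackets over a perfect matching of `L`; it dehomogenizes to a product of
-- differences of distinct variables.
theorem exists_invariant_ne_zero (hL : Fintype.card L = 8) :
    ∃ x ∈ diagPiece k U L 1, x ∈ slInvariants k U L ∧ x ≠ 0 := by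
  obtain ⟨e⟩ : Nonempty (Fin 4 × Fin 2 ≃ L) := Fintype.card_eq.1 (by simp [hL])
  refine ⟨∏ m : Fin 4, bracket b (e (m, 0)) (e (m, 1)), ?_, ?_, ?_⟩
  · have h := prod_mem_multilinearPiece (k := k) (U := U)
      (S := fun m : Fin 4 => {e (m, 0), e (m, 1)}) (fun m n h => by simp [h.symm])
      (fun m => bracket_mem_multilinearPiece b (by simp)) Finset.univ
    rw [← multilinearPiece_univ]
    convert h
    refine (Finset.eq_univ_iff_forall.2 fun i => ?_).symm
    obtain ⟨⟨m, j⟩, rfl⟩ := e.surjective i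
    rw [Finset.mem_biUnion]
    refine ⟨m, Finset.mem_univ _, ?_⟩
    fin_cases j <;> simp
  · exact Subalgebra.prod_mem _ fun m _ => bracket_mem_slInvariants b _ _
  · intro h
    have h1 := congrArg (dehom b) h
    rw [map_prod, map_zero, Finset.prod_eq_zero_iff] at h1
    obtain ⟨m, -, hm⟩ := h1
    rw [dehom_bracket, sub_eq_zero, MvPolynomial.X_inj] at hm
    simp at hm

/-- The coefficient vectors of invariants form a non-zero `S_L`-stable subspace of the harmonic
functions, so irreducibility leaves only the whole space. -/
theorem ofCoeffs_mem_slInvariants [CharZero k] (hL : Fintype.card L = 8) {c : Finset L → k}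
    (hc : c ∈ harmonic k L) : ofCoeffs b c ∈ slInvariants k U L := by
  set N : Submodule k (Finset L → k) :=
    (slInvariants k U L).toSubmodule.comap (ofCoeffs b) with hN
  have h : N = harmonic k L := by
    refine harmonic_irreducible hL (fun c hc => mem_harmonic_of_ofCoeffs_mem b hL hc) ?_ ?_
    · intro σ v hv g
      have h1 := permAct_ofCoeffs b σ⁻¹ v
      rw [inv_inv] at h1
      rw [← h1, permAct_slAct, hv g]
    · obtain ⟨x, hx, hx1, hx0⟩ := exists_invariant_ne_zero b hL
      rw [← range_ofCoeffs b] at hx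
      obtain ⟨c, rfl⟩ := hx
      refine (Submodule.ne_bot_iff _).2 ⟨c, hx1, ?_⟩
      rintro rfl
      exact hx0 (map_zero _)
  rw [← h] at hc
  exact hc

/-- The coordinate functions of `V_L`. -/
def degOneCoord (A : Finset L) : Module.Dual k (invDegOne k U L) :=
  multiCoeff b A ∘ₗ (invDegOne k U L).subtype

theorem degOneCoord_mem_harmonic [CharZero k] (hL : Fintype.card L = 8) (v : invDegOne k U L) :
    (fun A => degOneCoord b A v) ∈ harmonic k L := by
  refine mem_harmonic_of_ofCoeffs_mem b hL ?_
  have h := eq_ofCoeffs b v.2.1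
  have h1 := v.2.2
  rw [h] at h1
  exact h1

theorem coe_eq_sum_degOneCoord (v : invDegOne k U L) :
    (v : Ambient k U L) = ∑ A, degOneCoord b A v • multiMon b A := by
  conv_lhs => rw [eq_ofCoeffs b v.2.1, ofCoeffs_apply]
  rfl

/-- The degree one invariants are the harmonic functions. -/
def degOneEquiv [CharZero k] (hL : Fintype.card L = 8) : invDegOne k U L ≃ₗ[k] harmonic k L where
  toFun v := ⟨fun A => degOneCoord b A v, degOneCoord_mem_harmonic b hL v⟩
  map_add' v w := by ext; simp
  map_smul' r v := by ext; simp
  invFun c := ⟨ofCoeffs b c.1, ofCoeffs_mem_diagPiece b _, ofCoeffs_mem_slInvariants b hL c.2⟩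
  left_inv v := Subtype.ext (eq_ofCoeffs b v.2.1).symm
  right_inv c := by ext A; exact multiCoeff_ofCoeffs b c.1 A

include b in
theorem finrank_invDegOne [CharZero k] (hL : Fintype.card L = 8) :
    Module.finrank k (invDegOne k U L) = 14 := by
  rw [(degOneEquiv b hL).finrank_eq, finrank_harmonic hL]

theorem degOneCoord_comp_permDegOne (σ : Equiv.Perm L) (A : Finset L) :
    degOneCoord b A ∘ₗ permDegOne k U σ = degOneCoord b (σ⁻¹ • A) := by
  ext v
  change multiCoeff b A (permAct k U L σ v.1) = multiCoeff b (σ⁻¹ • A) v.1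
  conv_lhs => rw [eq_ofCoeffs b v.2.1, permAct_ofCoeffs, multiCoeff_ofCoeffs]

include b in
theorem invDegOne_irreducible [CharZero k] (hL : Fintype.card L = 8)
    {N : Submodule k (invDegOne k U L)} (hN : ∀ σ, ∀ v ∈ N, permDegOne k U σ v ∈ N)
    (h0 : N ≠ ⊥) : N = ⊤ := by
  set f : invDegOne k U L →ₗ[k] Finset L → k :=
    (harmonic k L).subtype ∘ₗ (degOneEquiv b hL).toLinearMap with hf
  have hinj : Function.Injective f :=
    Subtype.val_injective.comp (degOneEquiv b hL).injective
  have hrange : LinearMap.range f = harmonic k L := by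
    rw [hf, LinearMap.range_comp, LinearEquiv.range, Submodule.map_subtype_top]
  have h := harmonic_irreducible hL (N := N.map f) ?_ ?_ ?_
  · rw [← hrange, ← Submodule.map_top] at h
    exact Submodule.map_injective_of_injective hinj h
  · rw [← hrange]; exact LinearMap.map_le_range
  · rintro σ _ ⟨v, hv, rfl⟩
    refine ⟨permDegOne k U σ⁻¹ v, hN _ _ hv, ?_⟩
    ext A
    have h1 := LinearMap.congr_fun (degOneCoord_comp_permDegOne b σ⁻¹ A) v
    rwa [inv_inv] at h1
  · rw [← Submodule.map_bot f]
    exact fun h => h0 (Submodule.map_injective_of_injective hinj h)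

theorem span_degOneCoord [CharZero k] (hL : Fintype.card L = 8) :
    Submodule.span k (Set.range (degOneCoord (L := L) b)) = ⊤ := by
  rw [eq_top_iff]
  intro φ _
  -- Extended to all functions on subsets, a functional is a combination of evaluations.
  obtain ⟨ψ, hψ⟩ := LinearMap.exists_extend (φ ∘ₗ (degOneEquiv b hL).symm.toLinearMap)
  have h : φ = ∑ A, ψ (Pi.single A 1) • degOneCoord b A := by
    ext v
    have h1 := LinearMap.congr_fun hψ (degOneEquiv b hL v)
    simp only [LinearMap.comp_apply, LinearEquiv.coe_coe, LinearEquiv.symm_apply_apply] at h1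
    rw [← h1, LinearMap.pi_apply_eq_sum_univ ψ, LinearMap.sum_apply]
    refine Finset.sum_congr rfl fun A _ => ?_
    rw [smul_eq_mul, mul_comm, LinearMap.smul_apply, smul_eq_mul]
    congr 2
    ext B
    simp [Pi.single_apply, eq_comm]
  rw [h]
  exact Submodule.sum_mem _ fun A _ =>
    Submodule.smul_mem _ _ (Submodule.subset_span ⟨A, rfl⟩)

end DegreeOne

/-! ### Derivatives of a skew-invariant cubic: relations and independence -/

section Relations

open scoped Pointwise

variable {k : Type*} [Field k] {U : Type*} [AddCommGroup U] [Module k U] {L : Type*}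

theorem symPow_two_le_span (b : Module.Basis (Fin 2) k U) :
    symPow k (Module.Dual k U) 2 ≤ Submodule.span k (Set.range
      ![SymmetricAlgebra.ι k _ (b.coord 0) * SymmetricAlgebra.ι k _ (b.coord 0),
        SymmetricAlgebra.ι k _ (b.coord 0) * SymmetricAlgebra.ι k _ (b.coord 1),
        SymmetricAlgebra.ι k _ (b.coord 1) * SymmetricAlgebra.ι k _ (b.coord 1)]) := by
  rw [symPow, pow_two, Submodule.mul_le]
  rintro _ ⟨φ, rfl⟩ _ ⟨ψ, rfl⟩
  rw [eq_coord_add_coord b φ, eq_coord_add_coord b ψ]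
  simp only [map_add, map_smul]
  rw [Submodule.mem_span_range_iff_exists_fun]
  refine ⟨![φ (b 0) * ψ (b 0), φ (b 0) * ψ (b 1) + φ (b 1) * ψ (b 0), φ (b 1) * ψ (b 1)], ?_⟩
  simp only [Fin.sum_univ_three, Matrix.cons_val_zero, Matrix.cons_val_one, Matrix.cons_val,
    Algebra.smul_def, map_add, map_mul]
  ring

theorem not_linearIndependent_of_mem_span {M κ κ' : Type*} [AddCommGroup M] [Module k M]
    [Fintype κ] [Fintype κ'] (p : κ' → M) (hκ : Fintype.card κ' < Fintype.card κ) {g : κ → M}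
    (hg : ∀ i, g i ∈ Submodule.span k (Set.range p)) : ¬ LinearIndependent k g := by
  classical
  intro h
  refine hκ.not_ge ((linearIndependent_le_span_aux' g h (Set.range p) ?_).trans
    (Fintype.card_range_le p))
  rintro _ ⟨i, rfl⟩
  exact hg i

/-- On a pure tensor the sum is an alternating map of the factors indexed by `A`. These are more
than three vectors in `Sym² U*`, which is spanned by three, hence dependent. -/
theorem sum_sign_permAct_eq_zero [DecidableEq L] (b : Module.Basis (Fin 2) k U) {A : Finset L}
    (hA : 3 < A.card) {x : Ambient k U L} (hx : x ∈ diagPiece k U L 2) :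
    ∑ σ : Equiv.Perm {i // i ∈ A},
      (((Equiv.Perm.sign σ : ℤˣ) : ℤ) : k) •
        permAct k U L (Equiv.Perm.ofSubtype σ⁻¹) x = 0 := by
  set T : Ambient k U L →ₗ[k] Ambient k U L := ∑ σ : Equiv.Perm {i // i ∈ A},
    (((Equiv.Perm.sign σ : ℤˣ) : ℤ) : k) • permAct k U L (Equiv.Perm.ofSubtype σ⁻¹) with hT
  have hTx : ∀ y, T y = ∑ σ : Equiv.Perm {i // i ∈ A},
      (((Equiv.Perm.sign σ : ℤˣ) : ℤ) : k) •
        permAct k U L (Equiv.Perm.ofSubtype σ⁻¹) y := fun y => by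
    simp [hT, LinearMap.sum_apply]
  rw [← hTx]
  have hle : diagPiece k U L 2 ≤ LinearMap.ker T := by
    rw [diagPiece, Submodule.span_le]
    rintro _ ⟨f, hf, rfl⟩
    have h := AlternatingMap.map_linearDependent
      (MultilinearMap.alternatization
        ((PiTensorProduct.tprod k (s := fun _ : L => SymmetricAlgebra k (Module.Dual k U)))
          |>.domDomRestrict (fun i => i ∈ A) fun i => f i.1)) (fun i => f i.1)
      (not_linearIndependent_of_mem_span _ (by simpa using hA)
        fun i => symPow_two_le_span b (hf i.1))
    rw [MultilinearMap.alternatization_apply] at h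
    rw [SetLike.mem_coe, LinearMap.mem_ker, hTx, ← h]
    refine Finset.sum_congr rfl fun σ _ => ?_
    rw [Units.smul_def, ← Int.cast_smul_eq_zsmul k]
    congr 1
    -- `permAct` moves arguments by the inverse permutation, hence the `σ⁻¹` in the statement.
    rw [permAct_tprod, MultilinearMap.domDomCongr_apply, MultilinearMap.domDomRestrict_apply]
    congr 1
    funext i
    split_ifs with hi
    · rw [map_inv, ← Equiv.Perm.inv_def, inv_inv, Equiv.Perm.ofSubtype_apply_of_mem _ hi]
    · rw [map_inv, ← Equiv.Perm.inv_def, inv_inv, Equiv.Perm.ofSubtype_apply_of_not_mem _ hi]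
  exact hle hx

/-- Each term of the signed sum equals `x`, so `|A|! • x = 0`. -/
theorem eq_zero_of_alternating [CharZero k] [Fintype L] [DecidableEq L]
    (b : Module.Basis (Fin 2) k U) {A : Finset L}
    (hA : 3 < A.card) {x : Ambient k U L} (hx : x ∈ diagPiece k U L 2)
    (h : ∀ σ : Equiv.Perm L, σ • A = A →
      permAct k U L σ x = (((Equiv.Perm.sign σ : ℤˣ) : ℤ) : k) • x) : x = 0 := by
  have h1 := sum_sign_permAct_eq_zero b hA hx
  have h2 : ∀ σ : Equiv.Perm {i // i ∈ A},
      (((Equiv.Perm.sign σ : ℤˣ) : ℤ) : k) •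
        permAct k U L (Equiv.Perm.ofSubtype σ⁻¹) x = x := by
    intro σ
    rw [h, Equiv.Perm.sign_ofSubtype, Equiv.Perm.sign_inv, smul_smul, ← Int.cast_mul,
      ← Units.val_mul, Int.units_mul_self, Units.val_one, Int.cast_one, one_smul]
    refine Finset.eq_of_subset_of_card_le ?_ (Finset.card_smul_finset _ _).ge
    intro z hz
    obtain ⟨w, hw, rfl⟩ := Finset.mem_smul_finset.1 hz
    rw [Equiv.Perm.smul_def, Equiv.Perm.ofSubtype_apply_of_mem _ hw]
    exact Subtype.property _
  rw [Finset.sum_congr rfl fun σ _ => h2 σ, Finset.sum_const, ← Nat.cast_smul_eq_nsmul k] at h1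
  exact (smul_eq_zero.1 h1).resolve_left (by
    simp [Finset.card_univ, Fintype.card_perm, Nat.factorial_ne_zero])

/-- The map from `Sym(V_L)` to `Sym(U*)^{⊗ L}`. -/
def symToAmbient (k : Type*) [Field k] (U : Type*) [AddCommGroup U] [Module k U] (L : Type*) :
    SymmetricAlgebra k (invDegOne k U L) →ₐ[k] Ambient k U L :=
  (invRing k U L).val.comp (symToInvRing k U L)

theorem symToAmbient_ι (v : invDegOne k U L) :
    symToAmbient k U L (SymmetricAlgebra.ι k _ v) = v := by
  change ((symToInvRing k U L (SymmetricAlgebra.ι k _ v) : invRing k U L) : Ambient k U L) = v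
  rw [symToInvRing, SymmetricAlgebra.lift_ι_apply]
  rfl

theorem mem_relIdeal_iff {p : SymmetricAlgebra k (invDegOne k U L)} :
    p ∈ relIdeal k U L ↔ symToAmbient k U L p = 0 := by
  rw [relIdeal, RingHom.mem_ker]
  exact Subtype.ext_iff

theorem mem_relPiece_iff {d : ℕ} {p : SymmetricAlgebra k (invDegOne k U L)} :
    p ∈ relPiece k U L d ↔ symToAmbient k U L p = 0 ∧ p ∈ symPow k (invDegOne k U L) d := by
  rw [relPiece, Submodule.mem_inf, Submodule.restrictScalars_mem, mem_relIdeal_iff]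

theorem symToAmbient_mem_diagPiece {d : ℕ} {p : SymmetricAlgebra k (invDegOne k U L)}
    (hp : p ∈ symPow k (invDegOne k U L) d) : symToAmbient k U L p ∈ diagPiece k U L d := by
  induction d generalizing p with
  | zero =>
    obtain ⟨c, rfl⟩ := mem_symPow_zero hp
    rw [AlgHom.commutes, Algebra.algebraMap_eq_smul_one]
    exact Submodule.smul_mem _ _ one_mem_diagPiece
  | succ d ih =>
    refine symPow_succ_induction (fun v q hq => ?_) (fun p q hp hq => ?_) hp
    · rw [map_mul, symToAmbient_ι, add_comm d 1]
      exact diagPiece_mul_le 1 d (Submodule.mul_mem_mul v.2.1 (ih hq))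
    · rw [map_add]; exact add_mem hp hq

theorem permAct_one (σ : Equiv.Perm L) : permAct k U L σ 1 = 1 := by
  rw [PiTensorProduct.one_def, permAct_tprod]; rfl

theorem permAct_mul (σ : Equiv.Perm L) (x y : Ambient k U L) :
    permAct k U L σ (x * y) = permAct k U L σ x * permAct k U L σ y := by
  induction x using PiTensorProduct.induction_on with
  | smul_tprod r f =>
    induction y using PiTensorProduct.induction_on with
    | smul_tprod t h =>
      simp only [map_smul, smul_mul_assoc, mul_smul_comm, PiTensorProduct.tprod_mul_tprod,
        permAct_tprod]
      rfl
    | add a b ha hb => simp only [mul_add, map_add, ha, hb]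
  | add a b ha hb => simp only [add_mul, map_add, ha, hb]

/-- The action of a permutation on `Sym(U*)^{⊗ L}` as an algebra map. -/
def permActHom (σ : Equiv.Perm L) : Ambient k U L →ₐ[k] Ambient k U L :=
  AlgHom.ofLinearMap (permAct k U L σ) (permAct_one σ) (permAct_mul σ)

theorem symToAmbient_symMap (σ : Equiv.Perm L) (p : SymmetricAlgebra k (invDegOne k U L)) :
    symToAmbient k U L (symMap k (permDegOne k U σ) p) =
      permAct k U L σ (symToAmbient k U L p) := by
  have h : (symToAmbient k U L).comp (symMap k (permDegOne k U σ)) =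
      (permActHom σ).comp (symToAmbient k U L) := by
    refine SymmetricAlgebra.algHom_ext (LinearMap.ext fun v => ?_)
    change symToAmbient k U L (symMap k (permDegOne k U σ) (SymmetricAlgebra.ι k _ v)) =
      permAct k U L σ (symToAmbient k U L (SymmetricAlgebra.ι k _ v))
    rw [symMap_ι, symToAmbient_ι, symToAmbient_ι]
    rfl
  exact DFunLike.congr_fun h p

theorem permAct_permAct_inv (σ : Equiv.Perm L) (x : Ambient k U L) :
    permAct k U L σ (permAct k U L σ⁻¹ x) = x := by
  induction x using PiTensorProduct.induction_on with
  | smul_tprod r f =>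
    rw [map_smul, map_smul, permAct_tprod, permAct_tprod]
    congr 2
    funext i
    exact congrArg f (σ.apply_symm_apply i)
  | add a b ha hb => rw [map_add, map_add, ha, hb]

theorem permDegOne_comp_inv (σ : Equiv.Perm L) :
    permDegOne k U σ ∘ₗ permDegOne k U σ⁻¹ = LinearMap.id :=
  LinearMap.ext fun v => Subtype.ext (permAct_permAct_inv σ v.1)

theorem eq_top_of_dualCoannihilator_eq_bot {M κ : Type*} [AddCommMonoid M] [Module k M]
    [Finite κ] (c : Module.Basis κ k M) {K : Submodule k (Module.Dual k M)}
    (h : K.dualCoannihilator = ⊥) : K = ⊤ := by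
  let : AddCommGroup M := Module.addCommMonoidToAddCommGroup k
  have : Module.Finite k M := Module.Finite.of_basis c
  have h1 := Subspace.dualCoannihilator_dualAnnihilator_eq (W := K)
  rw [← h1, h, Submodule.dualAnnihilator_bot]

variable [Fintype L] [DecidableEq L] (b : Module.Basis (Fin 2) k U)

omit b in
theorem IsSkewInvariant.symMap_eq {s : SymmetricAlgebra k (invDegOne k U L)}
    (hs : IsSkewInvariant s) (σ : Equiv.Perm L) :
    symMap k (permDegOne k U σ) s = (((Equiv.Perm.sign σ : ℤˣ) : ℤ) : k) • s := by
  rw [hs σ, Int.cast_smul_eq_zsmul]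

/-- The coordinate of `A` is fixed by the stabilizer of `A`, so the derivative along it inherits the
sign character from `s`. -/
theorem symMap_partialDeriv_degOneCoord {s : SymmetricAlgebra k (invDegOne k U L)}
    (hs : IsSkewInvariant s) {σ : Equiv.Perm L} {A : Finset L} (hσ : σ • A = A) :
    symMap k (permDegOne k U σ) (partialDeriv k (degOneCoord b A) s) =
      (((Equiv.Perm.sign σ : ℤˣ) : ℤ) : k) • partialDeriv k (degOneCoord b A) s := by
  have h := partialDeriv_symMap (permDegOne k U σ) (degOneCoord b A) s
  rw [degOneCoord_comp_permDegOne, inv_smul_eq_iff.2 hσ.symm, hs.symMap_eq,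
    Derivation.map_smul] at h
  exact h.symm

include b in
/-- The derivatives of a skew-invariant cubic are relations. -/
theorem partialDeriv_mem_relPiece [CharZero k] (hL : Fintype.card L = 8)
    {s : SymmetricAlgebra k (invDegOne k U L)} (hs3 : s ∈ symPow k (invDegOne k U L) 3)
    (hs : IsSkewInvariant s) (φ : Module.Dual k (invDegOne k U L)) :
    partialDeriv k φ s ∈ relPiece k U L 2 := by
  have hφ : φ ∈ Submodule.span k (Set.range (degOneCoord (L := L) b)) := by
    rw [span_degOneCoord b hL]; trivial
  have hle : Submodule.span k (Set.range (degOneCoord (L := L) b)) ≤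
      (relPiece k U L 2).comap (partialDerivHom s) := by
    rw [Submodule.span_le]
    rintro _ ⟨A, rfl⟩
    -- For `|A| = 4` the derivative is alternating in more points than `dim Sym² U* = 3`; otherwise
    -- the coordinate is zero.
    by_cases hA : A.card = 4
    · have hmem := partialDeriv_mem_symPow (degOneCoord b A) hs3
      refine mem_relPiece_iff.2 ⟨eq_zero_of_alternating b (A := A) (by omega)
        (symToAmbient_mem_diagPiece hmem) fun σ hσ => ?_, hmem⟩
      rw [partialDerivHom_apply, ← symToAmbient_symMap, symMap_partialDeriv_degOneCoord b hs hσ,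
        map_smul]
    · have h0 : degOneCoord b A = (0 : Module.Dual k (invDegOne k U L)) := by
        ext v
        exact (degOneCoord_mem_harmonic b hL v).1 A hA
      rw [h0]
      exact zero_mem ((relPiece k U L 2).comap (partialDerivHom s))
  exact hle hφ

include b in
/-- The derivatives of a non-zero skew-invariant form along linearly independent directions are
linearly independent. -/
theorem partialDerivHom_injective [CharZero k] (hL : Fintype.card L = 8)
    {s : SymmetricAlgebra k (invDegOne k U L)} {d : ℕ}
    (hsd : s ∈ symPow k (invDegOne k U L) (d + 1)) (hs0 : s ≠ 0) (hs : IsSkewInvariant s)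
    {κ : Type*} [Fintype κ] (c : Module.Basis κ k (invDegOne k U L)) :
    Function.Injective (partialDerivHom s) := by
  set K := LinearMap.ker (partialDerivHom s) with hK
  have hstab : ∀ σ : Equiv.Perm L, ∀ φ ∈ K, φ ∘ₗ permDegOne k U σ ∈ K := by
    intro σ φ hφ
    rw [hK, LinearMap.mem_ker, partialDerivHom_apply] at hφ ⊢
    refine partialDeriv_eq_zero_of_symMap_eq_smul (permDegOne k U σ⁻¹) _ (by simp)
      (hs.symMap_eq σ⁻¹) ?_
    rwa [LinearMap.comp_assoc, permDegOne_comp_inv, LinearMap.comp_id]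
  rw [← LinearMap.ker_eq_bot, ← hK]
  by_contra hne
  refine hs0 (eq_zero_of_partialDeriv_eq_zero c hsd fun φ => ?_)
  -- The common kernel of `K` in `V_L` is stable, hence zero or everything; if everything, then `K`
  -- would be zero.
  have htop : K = ⊤ := by
    refine eq_top_of_dualCoannihilator_eq_bot c ?_
    by_contra hne'
    have htop := invDegOne_irreducible b hL (N := K.dualCoannihilator) (fun σ v hv => by
      rw [Submodule.mem_dualCoannihilator] at hv ⊢
      exact fun φ hφ => hv _ (hstab σ φ hφ)) hne'
    refine hne (eq_bot_iff.2 fun φ hφ => (Submodule.mem_bot k).2 (LinearMap.ext fun v => ?_))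
    have hv : v ∈ K.dualCoannihilator := htop ▸ Submodule.mem_top
    exact (Submodule.mem_dualCoannihilator _).1 hv φ hφ
  have hφ : φ ∈ K := htop ▸ Submodule.mem_top
  exact hφ

end Relations

/-! ### Perfect matchings of an octagon and uncrossing -/

section Matchings

variable {α : Type*}

/-- The list of the endpoints of a list of pairs. -/
def endpoints (m : List (α × α)) : List α := m.flatMap fun p => [p.1, p.2]

theorem endpoints_cons (p : α × α) (m : List (α × α)) :
    endpoints (p :: m) = p.1 :: p.2 :: endpoints m := rfl

theorem endpoints_perm {m m' : List (α × α)} (h : m.Perm m') :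
    (endpoints m).Perm (endpoints m') := h.flatMap_right _

/-- The perfect matchings of a list of length `2 * n`. -/
def matchings [DecidableEq α] : ℕ → List α → List (List (α × α))
  | 0, _ => [[]]
  | _ + 1, [] => [[]]
  | n + 1, a :: l => l.flatMap fun b => (matchings n (l.erase b)).map ((a, b) :: ·)

/-- Up to reordering and flipping pairs, the pair containing the head of `l` comes first and starts
with it; the remaining pairs are treated recursively. An arbitrary `G` allows several invariants to
be carried along at once. -/
theorem exists_mem_matchings [DecidableEq α] {β : Type*} (n : ℕ) (l : List α)
    (m : List (α × α)) (hn : m.length = n) (hm : (endpoints m).Perm l) (G : List (α × α) → β)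
    (hperm : ∀ m m', m.Perm m' → G m = G m')
    (hswap : ∀ a b m, G ((a, b) :: m) = G ((b, a) :: m)) :
    ∃ m' ∈ matchings n l, G m = G m' := by
  induction n generalizing l m G with
  | zero => exact ⟨[], by simp [matchings], by rw [List.length_eq_zero_iff.1 hn]⟩
  | succ n ih =>
    match l with
    | [] =>
      have h := hm.length_eq
      obtain ⟨p, m, rfl⟩ := List.exists_cons_of_length_eq_add_one hn
      simp [endpoints_cons] at h
    | a :: l =>
      obtain ⟨b, r, hr, hG, hp⟩ : ∃ b r, r.length = n ∧ G m = G ((a, b) :: r) ∧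
          (endpoints ((a, b) :: r)).Perm (a :: l) := by
        have ha : a ∈ endpoints m := hm.mem_iff.2 List.mem_cons_self
        rw [endpoints, List.mem_flatMap] at ha
        obtain ⟨⟨x, y⟩, hp, ha⟩ := ha
        have hpm := List.perm_cons_erase hp
        have hlen : (m.erase (x, y)).length = n := by
          rw [List.length_erase_of_mem hp, hn]; rfl
        have hep := (endpoints_perm hpm).symm.trans hm
        simp only [List.mem_cons, List.not_mem_nil, or_false] at ha
        rcases ha with rfl | rfl
        · exact ⟨y, _, hlen, hperm _ _ hpm, hep⟩
        · refine ⟨x, _, hlen, (hperm _ _ hpm).trans (hswap _ _ _), ?_⟩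
          exact (List.Perm.swap _ _ _).trans hep
      rw [endpoints_cons, List.perm_cons] at hp
      have hb : b ∈ l := hp.mem_iff.1 List.mem_cons_self
      obtain ⟨m', hm', h⟩ := ih (l.erase b) r hr (List.cons_perm_iff_perm_erase.1 hp).2
        (fun m => G ((a, b) :: m)) (fun m m' h => hperm _ _ (h.cons _)) (fun c d m => by
          rw [hperm _ _ (List.Perm.swap _ _ _), hswap, hperm _ _ (List.Perm.swap _ _ _)])
      exact ⟨(a, b) :: m', List.mem_flatMap.2 ⟨b, hb, List.mem_map.2 ⟨m', hm', rfl⟩⟩,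
        hG.trans h⟩

/-- Total length of the chords of a matching of the vertices of an octagon. -/
def chordLength (m : List (Fin 8 × Fin 8)) : ℕ :=
  (m.map fun p => Nat.dist p.1 p.2 * (8 - Nat.dist p.1 p.2)).sum

/-- Some pair of chords can be replaced by shorter ones in both ways. -/
def IsShortenable (m : List (Fin 8 × Fin 8)) : Prop :=
  ∃ p ∈ m, ∃ q ∈ m.erase p,
    chordLength ((p.1, q.1) :: (p.2, q.2) :: (m.erase p).erase q) < chordLength m ∧
    chordLength ((p.1, q.2) :: (p.2, q.1) :: (m.erase p).erase q) < chordLength m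

instance : DecidablePred IsShortenable := fun m => by unfold IsShortenable; infer_instance

/-- The matchings of the vertices of an octagon without crossings. -/
def planarMatchings : List (List (Fin 8 × Fin 8)) :=
  (matchings 4 (List.finRange 8)).filter fun m => ¬ IsShortenable m

/-- The Catalan number of index 4, found by running through all 105 matchings. Shortenable means
crossing: with the weight `d * (8 - d)`, uncrossing two chords in either way lowers the total by
twice the product of two opposite arcs. -/
theorem length_planarMatchings : planarMatchings.length = 14 := by decide +kernel

theorem chordLength_perm {m m' : List (Fin 8 × Fin 8)} (h : m.Perm m') :
    chordLength m = chordLength m' := (h.map _).sum_eq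

theorem chordLength_swap (a b : Fin 8) (m : List (Fin 8 × Fin 8)) :
    chordLength ((a, b) :: m) = chordLength ((b, a) :: m) := by
  simp [chordLength, Nat.dist_comm]

/-- A function on perfect matchings of an octagon satisfying the three-term relations vanishes if
it vanishes on the matchings without crossings. -/
theorem eq_zero_of_planarMatchings {M : Type*} [AddCommGroup M] {F : List (Fin 8 × Fin 8) → M}
    (hperm : ∀ m m', m.Perm m' → F m = F m')
    (hswap : ∀ a b m, F ((a, b) :: m) = F ((b, a) :: m))
    (hthree : ∀ a b c d m, F ((a, b) :: (c, d) :: m) + F ((a, c) :: (b, d) :: m) +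
      F ((a, d) :: (b, c) :: m) = 0)
    (h0 : ∀ m ∈ planarMatchings, F m = 0) (m : List (Fin 8 × Fin 8))
    (hm : (endpoints m).Perm (List.finRange 8)) : F m = 0 := by
  induction h : chordLength m using Nat.strong_induction_on generalizing m with
  | _ n ih =>
    subst h
    have hlen : m.length = 4 := by
      have h1 := hm.length_eq
      simp [endpoints] at h1
      omega
    obtain ⟨m', hm', hG⟩ := exists_mem_matchings 4 (List.finRange 8) m hlen hm
      -- The enumerated representative must keep the value, the length and the endpoints
      -- simultaneously.
      (fun m => (F m, chordLength m, (endpoints m : Multiset (Fin 8))))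
      (fun m m' h => by
        rw [hperm _ _ h, chordLength_perm h, Multiset.coe_eq_coe.2 (endpoints_perm h)])
      (fun a b m => by
        rw [hswap, chordLength_swap, endpoints_cons, endpoints_cons,
          Multiset.coe_eq_coe.2 (List.Perm.swap b a _)])
    simp only [Prod.mk.injEq, Multiset.coe_eq_coe] at hG
    obtain ⟨hF, hc, he⟩ := hG
    rw [hF]
    by_cases hs : IsShortenable m'
    -- The three-term relation expresses the value through the two re-pairings, both shorter and so
    -- already known to vanish.
    · obtain ⟨⟨a, b⟩, hp, ⟨c, d⟩, hq, h1, h2⟩ := hs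
      have hpm : m'.Perm ((a, b) :: (c, d) :: (m'.erase (a, b)).erase (c, d)) :=
        (List.perm_cons_erase hp).trans ((List.perm_cons_erase hq).cons _)
      generalize (m'.erase (a, b)).erase (c, d) = r at *
      have hend := (endpoints_perm hpm).symm.trans (he.symm.trans hm)
      rw [← hc] at h1 h2
      have e1 := ih _ h1 _ (List.Perm.trans (by
        simp only [endpoints_cons]
        exact ((List.Perm.swap b c _).cons _)) hend) rfl
      have e2 := ih _ h2 _ (List.Perm.trans (by
        simp only [endpoints_cons]
        refine List.Perm.cons _ ?_
        exact (List.Perm.swap b d _).trans ((List.Perm.swap c d _).cons _)) hend) rfl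
      have h3 := hthree a b c d r
      simp only at e1 e2
      rw [e1, e2, add_zero, add_zero] at h3
      rw [hperm _ _ hpm, h3]
    · exact h0 _ (List.mem_filter.2 ⟨hm', by simpa using hs⟩)

end Matchings

/-! ### Pair forms as functions on perfect matchings -/

section PairForms

variable {k : Type*} [Field k]

/-- Symmetric functions of pairs of `4`-subsets of `L`, harmonic in each of them, and supported on
the pairs meeting in two elements. -/
structure IsPairForm {L : Type*} [Fintype L] [DecidableEq L]
    (q : Finset L → Finset L → k) : Prop where
  harmonic : ∀ B, (fun A => q A B) ∈ harmonic k L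
  symm : ∀ A B, q A B = q B A
  eq_zero : ∀ A B, (A ∩ B).card ≠ 2 → q A B = 0

variable {L : Type*} [Fintype L] [DecidableEq L] {q : Finset L → Finset L → k}

theorem IsPairForm.compl_left [CharZero k] (hL : Fintype.card L = 8) (hq : IsPairForm q)
    (A B : Finset L) : q Aᶜ B = q A B := harmonic_compl hL (hq.harmonic B) A

theorem IsPairForm.compl_right [CharZero k] (hL : Fintype.card L = 8) (hq : IsPairForm q)
    (A B : Finset L) : q A Bᶜ = q A B := by
  rw [hq.symm, hq.compl_left hL, hq.symm]

theorem mem_of_nodup (hL : Fintype.card L = 8) {a b c d e f g h : L}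
    (hn : [a, b, c, d, e, f, g, h].Nodup) (x : L) :
    x = a ∨ x = b ∨ x = c ∨ x = d ∨ x = e ∨ x = f ∨ x = g ∨ x = h := by
  have h1 : [a, b, c, d, e, f, g, h].toFinset = Finset.univ := by
    rw [← Finset.card_eq_iff_eq_univ, List.toFinset_card_of_nodup hn, hL]; rfl
  have h2 := Finset.mem_univ x
  rw [← h1] at h2
  simpa using h2

/-- Harmonicity at `{a, b, c}` has five terms; those adding `e` or `f` vanish because the two sets
then meet in three points. -/
theorem IsPairForm.three_term (hL : Fintype.card L = 8) (hq : IsPairForm q)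
    {a b c d e f g h : L} (hn : [a, b, c, d, e, f, g, h].Nodup) :
    q {a, b, c, d} {a, b, e, f} + q {a, b, c, g} {a, b, e, f} + q {a, b, c, h} {a, b, e, f} =
      0 := by
  have hx := mem_of_nodup hL hn
  simp only [List.nodup_cons, List.mem_cons, List.not_mem_nil, or_false, not_or] at hn
  have h1 : ∑ x ∈ {a, b, c}ᶜ, q (insert x {a, b, c}) {a, b, e, f} = 0 :=
    (hq.harmonic {a, b, e, f}).2 {a, b, c} (by
    rw [Finset.card_eq_three]; exact ⟨a, b, c, by tauto⟩)
  have h2 : ({a, b, c} : Finset L)ᶜ = {d, e, f, g, h} := by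
    ext x
    have := hx x
    simp only [Finset.mem_compl, Finset.mem_insert, Finset.mem_singleton]
    grind
  have he : q (insert e {a, b, c}) {a, b, e, f} = 0 := hq.eq_zero _ _ (by
    have : insert e {a, b, c} ∩ {a, b, e, f} = ({a, b, e} : Finset L) := by
      ext x; simp only [Finset.mem_inter, Finset.mem_insert, Finset.mem_singleton]; grind
    rw [this, Finset.card_eq_three.2 ⟨a, b, e, by tauto⟩]; norm_num)
  have hf : q (insert f {a, b, c}) {a, b, e, f} = 0 := hq.eq_zero _ _ (by
    have : insert f {a, b, c} ∩ {a, b, e, f} = ({a, b, f} : Finset L) := by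
      ext x; simp only [Finset.mem_inter, Finset.mem_insert, Finset.mem_singleton]; grind
    rw [this, Finset.card_eq_three.2 ⟨a, b, f, by tauto⟩]; norm_num)
  rw [h2, Finset.sum_insert (by simp; tauto), Finset.sum_insert (by simp; tauto),
    Finset.sum_insert (by simp; tauto), Finset.sum_insert (by simp; tauto),
    Finset.sum_singleton, he, hf] at h1
  have hs : ∀ x, ({a, b, c, x} : Finset L) = insert x {a, b, c} := fun x => by
    ext y; simp only [Finset.mem_insert, Finset.mem_singleton]; tauto
  rw [hs d, hs g, hs h, ← h1]
  ring

/-- Regard `q {a, b, x, y} {a, b, e, f}` as a weight on the edges `xy` of the complete graph on `c,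
d, g, h`. The weights at each vertex sum to zero, so the relations at `g` and `h` minus those at `c`
and `d` give twice the difference of two opposite edges. -/
theorem IsPairForm.swap_opposite [CharZero k] (hL : Fintype.card L = 8) (hq : IsPairForm q)
    {a b c d e f g h : L} (hn : [a, b, c, d, e, f, g, h].Nodup) :
    q {a, b, g, h} {a, b, e, f} = q {a, b, c, d} {a, b, e, f} := by
  have t1 := hq.three_term hL hn
  have t2 := hq.three_term hL (a := a) (b := b) (c := d) (d := c) (e := e) (f := f) (g := g)
    (h := h) (by grind)
  have t3 := hq.three_term hL (a := a) (b := b) (c := g) (d := h) (e := e) (f := f) (g := c)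
    (h := d) (by grind)
  have t4 := hq.three_term hL (a := a) (b := b) (c := h) (d := g) (e := e) (f := f) (g := c)
    (h := d) (by grind)
  rw [Finset.pair_comm d c] at t2
  rw [Finset.pair_comm g c, Finset.pair_comm g d] at t3
  rw [Finset.pair_comm h c, Finset.pair_comm h d, Finset.pair_comm h g] at t4
  have h2 : (2 : k) ≠ 0 := two_ne_zero
  refine mul_left_cancel₀ h2 ?_
  linear_combination t3 + t4 - t1 - t2

/-- The value of a pair form on a list of four pairs. -/
def pairValue (q : Finset L → Finset L → k) : List (L × L) → k
  | [p, r, s, t] =>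
    if (endpoints [p, r, s, t]).Nodup then q {p.1, p.2, r.1, r.2} {p.1, p.2, s.1, s.2} else 0
  | _ => 0

omit [Fintype L] in
theorem pairValue_of_nodup {a b c d e f g h : L} (hn : [a, b, c, d, e, f, g, h].Nodup) :
    pairValue q [(a, b), (c, d), (e, f), (g, h)] = q {a, b, c, d} {a, b, e, f} := if_pos hn

omit [Fintype L] in
theorem pairValue_of_not_nodup {m : List (L × L)} (hn : ¬ (endpoints m).Nodup) :
    pairValue q m = 0 := by
  unfold pairValue
  split
  · rw [if_neg hn]
  · rfl

theorem IsPairForm.pairValue_swap_middle (hq : IsPairForm q) (p r s t : L × L) :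
    pairValue q [p, r, s, t] = pairValue q [p, s, r, t] := by
  have hperm : (endpoints [p, r, s, t]).Perm (endpoints [p, s, r, t]) :=
    endpoints_perm ((List.Perm.swap _ _ _).cons _)
  by_cases hn : (endpoints [p, r, s, t]).Nodup
  · rw [pairValue_of_nodup hn, pairValue_of_nodup (hperm.nodup_iff.1 hn), hq.symm]
  · rw [pairValue_of_not_nodup hn, pairValue_of_not_nodup (mt hperm.nodup_iff.2 hn)]

theorem IsPairForm.pairValue_swap_last [CharZero k] (hL : Fintype.card L = 8)
    (hq : IsPairForm q) (p r s t : L × L) :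
    pairValue q [p, r, s, t] = pairValue q [p, r, t, s] := by
  have hperm : (endpoints [p, r, s, t]).Perm (endpoints [p, r, t, s]) :=
    endpoints_perm (((List.Perm.swap _ _ _).cons _).cons _)
  have hperm' : (endpoints [p, r, s, t]).Perm (endpoints [p, s, r, t]) :=
    endpoints_perm ((List.Perm.swap _ _ _).cons _)
  by_cases hn : (endpoints [p, r, s, t]).Nodup
  · rw [pairValue_of_nodup hn, pairValue_of_nodup (hperm.nodup_iff.1 hn), hq.symm,
      ← hq.swap_opposite hL (hperm'.nodup_iff.1 hn), hq.symm]
  · rw [pairValue_of_not_nodup hn, pairValue_of_not_nodup (mt hperm.nodup_iff.2 hn)]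

theorem IsPairForm.pairValue_swap_first [CharZero k] (hL : Fintype.card L = 8)
    (hq : IsPairForm q) (p r s t : L × L) :
    pairValue q [p, r, s, t] = pairValue q [r, p, s, t] := by
  have hperm : (endpoints [p, r, s, t]).Perm (endpoints [r, p, s, t]) :=
    endpoints_perm (List.Perm.swap _ _ _)
  by_cases hn : (endpoints [p, r, s, t]).Nodup
  · have hn' := hperm.nodup_iff.1 hn
    obtain ⟨a, b⟩ := p
    obtain ⟨c, d⟩ := r
    obtain ⟨e, f⟩ := s
    obtain ⟨g, h⟩ := t
    rw [hq.pairValue_swap_last hL, pairValue_of_nodup hn', pairValue_of_nodup (by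
      simp only [endpoints_cons] at hn
      grind)]
    dsimp only
    -- The complement of `r ∪ s` is `p ∪ t`, so complement invariance exchanges the two
    -- descriptions.
    rw [← hq.compl_right hL _ {c, d, e, f}]
    have hx := mem_of_nodup hL hn
    have hn1 : [a, b, c, d, e, f, g, h].Nodup := hn
    simp only [List.nodup_cons, List.mem_cons, List.not_mem_nil, or_false, not_or] at hn1
    congr 1
    · ext x; simp only [Finset.mem_insert, Finset.mem_singleton]; tauto
    · ext x
      have := hx x
      simp only [Finset.mem_compl, Finset.mem_insert, Finset.mem_singleton]
      simp only at this
      grind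
  · rw [pairValue_of_not_nodup hn, pairValue_of_not_nodup (mt hperm.nodup_iff.2 hn)]

/-- Only a total length of four has content, namely the three adjacent transpositions; in all other
lengths both values are the default zero. -/
theorem IsPairForm.pairValue_append_swap [CharZero k] (hL : Fintype.card L = 8)
    (hq : IsPairForm q) (l : List (L × L)) (x y : L × L) (t : List (L × L)) :
    pairValue q (l ++ x :: y :: t) = pairValue q (l ++ y :: x :: t) := by
  match l, t with
  | [], [] => rfl
  | [], [_] => rfl
  | [], [_, _] => exact hq.pairValue_swap_first hL _ _ _ _
  | [], _ :: _ :: _ :: _ => rfl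
  | [_], [] => rfl
  | [_], [_] => exact hq.pairValue_swap_middle _ _ _ _
  | [_], _ :: _ :: _ => rfl
  | [_, _], [] => exact hq.pairValue_swap_last hL _ _ _ _
  | [_, _], _ :: _ => rfl
  | _ :: _ :: _ :: [], _ => rfl
  | _ :: _ :: _ :: _ :: [], _ => rfl
  | _ :: _ :: _ :: _ :: _ :: _, _ => rfl

theorem IsPairForm.pairValue_perm [CharZero k] (hL : Fintype.card L = 8) (hq : IsPairForm q)
    {m m' : List (L × L)} (h : m.Perm m') : pairValue q m = pairValue q m' := by
  -- A prefix is needed because `pairValue` has no recursion along `cons`.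
  suffices ∀ l, pairValue q (l ++ m) = pairValue q (l ++ m') from this []
  induction h with
  | nil => exact fun _ => rfl
  | cons x _ ih => exact fun l => by simpa using ih (l ++ [x])
  | swap x y t => exact fun l => hq.pairValue_append_swap hL l y x t
  | trans _ _ ih1 ih2 => exact fun l => (ih1 l).trans (ih2 l)

omit [Fintype L] in
theorem pairValue_flip (a b : L) (m : List (L × L)) :
    pairValue q ((a, b) :: m) = pairValue q ((b, a) :: m) := by
  have hperm : (endpoints ((a, b) :: m)).Perm (endpoints ((b, a) :: m)) := List.Perm.swap _ _ _
  by_cases hn : (endpoints ((a, b) :: m)).Nodup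
  · match m, hn, hperm with
    | [], _, _ => rfl
    | [_], _, _ => rfl
    | [_, _], _, _ => rfl
    | [r, s, t], hn, hperm =>
      rw [pairValue_of_nodup hn, pairValue_of_nodup (hperm.nodup_iff.1 hn),
        Finset.insert_comm a b, Finset.insert_comm a b]
    | _ :: _ :: _ :: _ :: _, _, _ => rfl
  · rw [pairValue_of_not_nodup hn, pairValue_of_not_nodup (mt hperm.nodup_iff.2 hn)]

theorem IsPairForm.pairValue_three_term [CharZero k] (hL : Fintype.card L = 8)
    (hq : IsPairForm q) (a b c d : L) (m : List (L × L)) :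
    pairValue q ((a, b) :: (c, d) :: m) + pairValue q ((a, c) :: (b, d) :: m) +
      pairValue q ((a, d) :: (b, c) :: m) = 0 := by
  have hp1 : (endpoints ((a, b) :: (c, d) :: m)).Perm (endpoints ((a, c) :: (b, d) :: m)) :=
    (List.Perm.swap _ _ _).cons _
  have hp2 : (endpoints ((a, b) :: (c, d) :: m)).Perm (endpoints ((a, d) :: (b, c) :: m)) :=
    List.Perm.cons _ (((List.Perm.swap d c _).cons b).trans (List.Perm.swap d b _))
  by_cases hn : (endpoints ((a, b) :: (c, d) :: m)).Nodup
  · match m, hn with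
    | [], _ => simp [pairValue]
    | [_], _ => simp [pairValue]
    | [(e, f), (g, h)], hn =>
      -- In this order the changing pairs are `A \ B` and the complement of `A ∪ B`, as `three_term`
      -- requires.
      have hr : ∀ p r : L × L, [p, r, (e, f), (g, h)].Perm [(e, f), p, (g, h), r] := fun p r =>
        ((List.Perm.swap _ _ _).cons p).trans ((List.Perm.swap _ _ _).trans
          (((List.Perm.swap _ _ _).cons _).cons _))
      rw [hq.pairValue_perm hL (hr _ _), hq.pairValue_perm hL (hr _ _),
        hq.pairValue_perm hL (hr _ _)]
      have hn1 : [e, f, a, b, g, h, c, d].Nodup :=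
        (endpoints_perm (hr (a, b) (c, d))).nodup_iff.1 hn
      rw [pairValue_of_nodup hn1, pairValue_of_nodup (by grind), pairValue_of_nodup (by grind)]
      exact hq.three_term hL hn1
    | _ :: _ :: _ :: _, _ => simp [pairValue]
  · rw [pairValue_of_not_nodup hn, pairValue_of_not_nodup (mt hp1.nodup_iff.2 hn),
      pairValue_of_not_nodup (mt hp2.nodup_iff.2 hn)]
    simp

/-- Two 4-subsets meeting in two points partition the eight points into the pairs `A ∩ B`, `A \ B`,
`B \ A` and the rest; every non-trivial value of `q` is thus a value on a perfect matching. -/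
theorem IsPairForm.eq_zero_of_planarMatchings [CharZero k]
    {q : Finset (Fin 8) → Finset (Fin 8) → k} (hq : IsPairForm q)
    (h0 : ∀ m ∈ planarMatchings, pairValue q m = 0) : q = 0 := by
  funext A B
  by_cases hA : A.card = 4
  swap
  · exact (hq.harmonic B).1 A hA
  by_cases hB : B.card = 4
  swap
  · rw [hq.symm]; exact (hq.harmonic A).1 B hB
  by_cases hAB : (A ∩ B).card = 2
  swap
  · exact hq.eq_zero A B hAB
  have h1 := Finset.card_sdiff_add_card_inter A B
  have h2 := Finset.card_sdiff_add_card_inter B A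
  rw [Finset.inter_comm] at h2
  have h3 := card_compl_sdiff (Fintype.card_fin 8) B A
  obtain ⟨a, b, hab, e1⟩ := Finset.card_eq_two.1 hAB
  obtain ⟨c, d, hcd, e2⟩ := Finset.card_eq_two.1 (by omega : (A \ B).card = 2)
  obtain ⟨e, f, hef, e3⟩ := Finset.card_eq_two.1 (by omega : (B \ A).card = 2)
  obtain ⟨g, h, hgh, e4⟩ := Finset.card_eq_two.1 (by omega : (Aᶜ \ B).card = 2)
  have hAe : A = {a, b, c, d} := (Finset.sdiff_union_inter A B).symm.trans (by
    rw [e1, e2, Finset.union_comm, Finset.insert_union, Finset.singleton_union])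
  have hBe : B = {a, b, e, f} := (Finset.sdiff_union_inter B A).symm.trans (by
    rw [Finset.inter_comm B A, e1, e3, Finset.union_comm, Finset.insert_union, Finset.singleton_union])
  have hn : [a, b, c, d, e, f, g, h].Nodup := by
    simp only [Finset.ext_iff, Finset.mem_inter, Finset.mem_sdiff, Finset.mem_compl,
      Finset.mem_insert, Finset.mem_singleton] at e1 e2 e3 e4
    have := e1 a; have := e1 b; have := e2 c; have := e2 d
    have := e3 e; have := e3 f; have := e4 g; have := e4 h
    simp only [List.nodup_cons, List.mem_cons, List.not_mem_nil, or_false, not_or]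
    grind
  have hz := PointsOnLine.eq_zero_of_planarMatchings (F := pairValue q)
    (fun m m' h => hq.pairValue_perm (Fintype.card_fin 8) h) pairValue_flip
    (hq.pairValue_three_term (Fintype.card_fin 8)) h0 [(a, b), (c, d), (e, f), (g, h)] (by
      refine (List.perm_ext_iff_of_nodup hn (List.nodup_finRange 8)).2 fun x => ?_
      have := mem_of_nodup (Fintype.card_fin 8) hn x
      simpa using this)
  rw [pairValue_of_nodup hn, ← hAe, ← hBe] at hz
  exact hz

omit [Fintype L] in
theorem pairValue_add (q q' : Finset L → Finset L → k) (m : List (L × L)) :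
    pairValue (fun A B => q A B + q' A B) m = pairValue q m + pairValue q' m := by
  unfold pairValue
  split
  · split_ifs <;> simp
  · simp

omit [Fintype L] in
theorem pairValue_smul (r : k) (q : Finset L → Finset L → k) (m : List (L × L)) :
    pairValue (fun A B => r * q A B) m = r * pairValue q m := by
  unfold pairValue
  split
  · split_ifs <;> simp
  · simp

theorem IsPairForm.relabel {L' : Type*} [Fintype L'] [DecidableEq L'] (hq : IsPairForm q)
    (e : L' ≃ L) :
    IsPairForm fun A B : Finset L' => q (A.map e.toEmbedding) (B.map e.toEmbedding) where
  harmonic B := by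
    refine ⟨fun A hA => (hq.harmonic _).1 _ (by rwa [Finset.card_map]), fun C hC => ?_⟩
    have h := (hq.harmonic (B.map e.toEmbedding)).2 (C.map e.toEmbedding) (by
      rwa [Finset.card_map])
    have hc : (C.map e.toEmbedding)ᶜ = Cᶜ.map e.toEmbedding := by
      ext x
      simp [Finset.mem_map_equiv]
    rw [hc, Finset.sum_map] at h
    simpa only [Finset.map_insert] using h
  symm A B := hq.symm _ _
  eq_zero A B h := hq.eq_zero _ _ (by rwa [← Finset.map_inter, Finset.card_map])

end PairForms

/-! ### Hessians of quadratic forms -/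

section Hessian

variable {k : Type*} [Field k] {M : Type*} [AddCommMonoid M] [Module k M]

/-- The constant term of the second derivative `∂_φ ∂_ψ p`. -/
def hessian (φ ψ : Module.Dual k M) : SymmetricAlgebra k M →ₗ[k] k :=
  (SymmetricAlgebra.algebraMapInv (R := k) (M := M)).toLinearMap ∘ₗ
    (partialDeriv k φ).toLinearMap ∘ₗ (partialDeriv k ψ).toLinearMap

theorem hessian_apply (φ ψ : Module.Dual k M) (p : SymmetricAlgebra k M) :
    hessian φ ψ p = SymmetricAlgebra.algebraMapInv (partialDeriv k φ (partialDeriv k ψ p)) := rfl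

theorem hessian_ι_mul_ι (φ ψ : Module.Dual k M) (v w : M) :
    hessian φ ψ (SymmetricAlgebra.ι k M v * SymmetricAlgebra.ι k M w) =
      φ v * ψ w + φ w * ψ v := by
  rw [hessian_apply, partialDeriv_ι_mul, partialDeriv_ι, map_add, partialDeriv_ι_mul,
    Derivation.map_algebraMap, Derivation.map_smul, partialDeriv_ι]
  simp [SymmetricAlgebra.algebraMapInv, mul_comm]

@[elab_as_elim]
theorem symPow_two_induction {motive : SymmetricAlgebra k M → Prop}
    (ι_mul_ι : ∀ v w, motive (SymmetricAlgebra.ι k M v * SymmetricAlgebra.ι k M w))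
    (add : ∀ p q, motive p → motive q → motive (p + q))
    {p : SymmetricAlgebra k M} (hp : p ∈ symPow k M 2) : motive p := by
  rw [symPow, pow_two] at hp
  induction hp using Submodule.mul_induction_on' with
  | mem_mul_mem m hm n hn =>
    obtain ⟨v, rfl⟩ := hm
    obtain ⟨w, rfl⟩ := hn
    exact ι_mul_ι v w
  | add x _ y _ hx hy => exact add x y hx hy

/-- Second derivatives of a quadratic form are constants, so their constant terms lose nothing; then
Euler's identity applies twice. -/
theorem eq_zero_of_hessian_eq_zero [CharZero k] {κ : Type*} [Fintype κ]
    (c : Module.Basis κ k M) {p : SymmetricAlgebra k M} (hp : p ∈ symPow k M 2)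
    {S : Set (Module.Dual k M)} (hS : Submodule.span k S = ⊤)
    (h : ∀ φ ∈ S, ∀ ψ ∈ S, hessian φ ψ p = 0) : p = 0 := by
  have key : ∀ φ ψ, partialDeriv k φ (partialDeriv k ψ p) = 0 := by
    have h1 : ∀ φ ∈ S, ∀ ψ ∈ S, partialDeriv k φ (partialDeriv k ψ p) = 0 := by
      intro φ hφ ψ hψ
      obtain ⟨r, hr⟩ := mem_symPow_zero
        (partialDeriv_mem_symPow φ (partialDeriv_mem_symPow ψ hp))
      have h2 := h φ hφ ψ hψ
      rw [hessian_apply, hr, AlgHom.commutes, Algebra.algebraMap_self, RingHom.id_apply] at h2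
      rw [hr, h2, map_zero]
    have h2 : ∀ φ, ∀ ψ ∈ S, partialDeriv k φ (partialDeriv k ψ p) = 0 := by
      intro φ ψ hψ
      have hle : Submodule.span k S ≤ LinearMap.ker (partialDerivHom (partialDeriv k ψ p)) :=
        Submodule.span_le.2 fun φ hφ => h1 φ hφ ψ hψ
      exact hle (hS ▸ Submodule.mem_top)
    intro φ ψ
    have hle : Submodule.span k S ≤
        LinearMap.ker ((partialDeriv k φ).toLinearMap ∘ₗ partialDerivHom p) :=
      Submodule.span_le.2 fun ψ hψ => h2 φ ψ hψ
    exact hle (hS ▸ Submodule.mem_top)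
  exact eq_zero_of_partialDeriv_eq_zero c hp fun ψ =>
    eq_zero_of_partialDeriv_eq_zero c (partialDeriv_mem_symPow ψ hp) fun φ => key φ ψ

theorem linearIndependent_coord {κ : Type*} [Finite κ] (c : Module.Basis κ k M) :
    LinearIndependent k c.coord := by
  classical
  have := Fintype.ofFinite κ
  rw [Fintype.linearIndependent_iff]
  intro g hg i
  have h := LinearMap.congr_fun hg (c i)
  simpa [LinearMap.sum_apply, Finsupp.single_apply] using h

end Hessian

/-! ### Quadratic relations and the upper bound on their dimension -/

section QuadraticRelations

variable {k : Type*} [Field k] {U : Type*} [AddCommGroup U] [Module k U]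
  {L : Type*} [Fintype L] [DecidableEq L] (b : Module.Basis (Fin 2) k U)

theorem dehom_coe (v : invDegOne k U L) :
    dehom b (v : Ambient k U L) =
      ∑ A, degOneCoord b A v • MvPolynomial.monomial (setExp A) 1 := by
  rw [coe_eq_sum_degOneCoord b v, map_sum]
  refine Finset.sum_congr rfl fun A _ => ?_
  rw [map_smul, dehom_multiMon, prod_X_eq_monomial]

/-- The Hessian of `v * w` counts both orders of the factors, hence the `2`. -/
theorem two_smul_dehom_symToAmbient {p : SymmetricAlgebra k (invDegOne k U L)}
    (hp : p ∈ symPow k (invDegOne k U L) 2) :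
    (2 : k) • dehom b (symToAmbient k U L p) =
      ∑ A, ∑ B, hessian (degOneCoord b A) (degOneCoord b B) p •
        MvPolynomial.monomial (setExp A + setExp B) 1 := by
  refine symPow_two_induction (fun v w => ?_) (fun p q hp hq => ?_) hp
  · rw [map_mul (symToAmbient k U L), map_mul (dehom b), symToAmbient_ι, symToAmbient_ι]
    simp only [hessian_ι_mul_ι, add_smul, Finset.sum_add_distrib]
    have h1 : ∀ v w : invDegOne k U L, dehom b (v : Ambient k U L) * dehom b w =
        ∑ A, ∑ B, (degOneCoord b A v * degOneCoord b B w) •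
          MvPolynomial.monomial (setExp A + setExp B) 1 := fun v w => by
      rw [dehom_coe, dehom_coe, Finset.sum_mul_sum]
      refine Finset.sum_congr rfl fun A _ => Finset.sum_congr rfl fun B _ => ?_
      rw [smul_mul_smul_comm, MvPolynomial.monomial_mul, one_mul]
    rw [← h1 v w, ← h1 w v, mul_comm (dehom b (w : Ambient k U L)), two_smul]
  · rw [map_add (symToAmbient k U L), map_add (dehom b), smul_add, hp, hq]
    simp only [map_add, add_smul, Finset.sum_add_distrib]

omit [Fintype L] in
-- The exponent determines the intersection and the union. Outside the intersection `A` and `B` have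
-- at most one point each, so only the order of the two sets is free.
theorem pair_eq_of_setExp_add {A B C D : Finset L} (hA : A.card = 4) (hB : B.card = 4)
    (hC : C.card = 4) (hAB : 3 ≤ (A ∩ B).card)
    (h : setExp C + setExp D = setExp A + setExp B) : C = A ∧ D = B ∨ C = B ∧ D = A := by
  have h1 : ∀ i, (i ∈ C ∧ i ∈ D ↔ i ∈ A ∧ i ∈ B) ∧ (i ∈ C ∨ i ∈ D ↔ i ∈ A ∨ i ∈ B) := by
    intro i
    have h2 := DFunLike.congr_fun h i
    simp only [Finsupp.add_apply, setExp_apply] at h2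
    grind
  by_cases hCA : C = A
  · subst hCA
    refine Or.inl ⟨rfl, ?_⟩
    ext i
    have := h1 i
    tauto
  · have hx : ∃ x ∈ A, x ∉ C := by
      by_contra! hh
      exact hCA (Finset.eq_of_subset_of_card_le hh (by omega)).symm
    obtain ⟨x, hxA, hxC⟩ := hx
    have hxB : x ∉ B := fun hh => hxC ((h1 x).1.2 ⟨hxA, hh⟩).1
    have hAx : A ∩ B = A.erase x := Finset.eq_of_subset_of_card_le (fun i hi => by
      rw [Finset.mem_inter] at hi
      exact Finset.mem_erase.2 ⟨fun hix => hxB (hix ▸ hi.2), hi.1⟩) (by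
      rw [Finset.card_erase_of_mem hxA]; omega)
    have hCB : C = B := Finset.eq_of_subset_of_card_le (fun i hi => by
      rcases (h1 i).2.1 (Or.inl hi) with hiA | hiB
      · have : i ∈ A ∩ B := hAx ▸ Finset.mem_erase.2 ⟨fun hix => hxC (hix ▸ hi), hiA⟩
        exact (Finset.mem_inter.1 this).2
      · exact hiB) (by omega)
    subst hCB
    refine Or.inr ⟨rfl, ?_⟩
    ext i
    have := h1 i
    tauto

omit [DecidableEq L] in
theorem hessian_degOneCoord_symm {p : SymmetricAlgebra k (invDegOne k U L)}
    (hp : p ∈ symPow k (invDegOne k U L) 2) (A B : Finset L) :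
    hessian (degOneCoord b A) (degOneCoord b B) p =
      hessian (degOneCoord b B) (degOneCoord b A) p := by
  refine symPow_two_induction (fun v w => ?_) (fun p q hp hq => ?_) hp
  · rw [hessian_ι_mul_ι, hessian_ι_mul_ι]; ring
  · rw [map_add, map_add, hp, hq]

theorem hessian_degOneCoord_mem_harmonic [CharZero k] (hL : Fintype.card L = 8)
    {p : SymmetricAlgebra k (invDegOne k U L)}
    (hp : p ∈ symPow k (invDegOne k U L) 2) (B : Finset L) :
    (fun A => hessian (degOneCoord b A) (degOneCoord b B) p) ∈ harmonic k L := by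
  refine symPow_two_induction (fun v w => ?_) (fun p q hp hq => ?_) hp
  · have h1 := Submodule.smul_mem _ (degOneCoord b B w) (degOneCoord_mem_harmonic b hL v)
    have h2 := Submodule.smul_mem _ (degOneCoord b B v) (degOneCoord_mem_harmonic b hL w)
    convert add_mem h1 h2 using 1
    ext A
    simp only [hessian_ι_mul_ι, Pi.add_apply, Pi.smul_apply, smul_eq_mul]
    ring
  · convert add_mem hp hq using 1
    ext A
    rw [map_add]; rfl

theorem hessian_eq_zero_of_three_le [CharZero k] (hL : Fintype.card L = 8)
    {p : SymmetricAlgebra k (invDegOne k U L)} (hp : p ∈ relPiece k U L 2) {A B : Finset L}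
    (hAB : 3 ≤ (A ∩ B).card) : hessian (degOneCoord b A) (degOneCoord b B) p = 0 := by
  rw [mem_relPiece_iff] at hp
  obtain ⟨hp0, hp2⟩ := hp
  set q : Finset L → Finset L → k :=
    fun A B => hessian (degOneCoord b A) (degOneCoord b B) p with hq
  have hsymm : ∀ A B, q A B = q B A := hessian_degOneCoord_symm b hp2
  have hcard : ∀ A B, A.card ≠ 4 → q A B = 0 := fun A B =>
    (hessian_degOneCoord_mem_harmonic b hL hp2 B).1 A
  change q A B = 0
  by_cases hA : A.card = 4
  swap
  · exact hcard A B hA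
  by_cases hB : B.card = 4
  swap
  · rw [hsymm]; exact hcard B A hB
  have h := two_smul_dehom_symToAmbient b hp2
  rw [hp0, map_zero, smul_zero] at h
  have h1 := congrArg (MvPolynomial.coeff (setExp A + setExp B)) h
  simp only [MvPolynomial.coeff_zero, MvPolynomial.coeff_sum, MvPolynomial.coeff_smul,
    MvPolynomial.coeff_monomial, smul_eq_mul, mul_ite, mul_one, mul_zero] at h1
  rw [← Finset.sum_product', ← Finset.sum_filter] at h1
  -- All terms contributing to this coefficient equal `q A B` or zero. Their number is kept as a
  -- natural number, so that positivity together with characteristic zero allows cancelling it.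
  have h2 : ∀ x ∈ Finset.filter (fun x : Finset L × Finset L =>
      setExp x.1 + setExp x.2 = setExp A + setExp B) (Finset.univ ×ˢ Finset.univ),
      q x.1 x.2 = (if x.1.card = 4 then 1 else 0 : ℕ) * q A B := by
    rintro ⟨C, D⟩ hx
    rw [Finset.mem_filter] at hx
    dsimp only at hx ⊢
    by_cases hC : C.card = 4
    · rcases pair_eq_of_setExp_add hA hB hC hAB hx.2 with ⟨rfl, rfl⟩ | ⟨rfl, rfl⟩
      · simp [hC]
      · rw [hsymm]; simp [hC]
    · rw [hcard _ _ hC, if_neg hC]; simp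
  rw [Finset.sum_congr rfl h2, ← Finset.sum_mul, ← Nat.cast_sum] at h1
  refine (mul_eq_zero.1 h1.symm).resolve_left (Nat.cast_ne_zero.2 (Finset.sum_pos' (by simp)
    ⟨(A, B), by simp, by simp [hA]⟩).ne')

theorem isPairForm_hessian [CharZero k] (hL : Fintype.card L = 8)
    {p : SymmetricAlgebra k (invDegOne k U L)} (hp : p ∈ relPiece k U L 2) :
    IsPairForm fun A B : Finset L => hessian (degOneCoord b A) (degOneCoord b B) p := by
  have hp2 := (mem_relPiece_iff.1 hp).2
  have hharm := hessian_degOneCoord_mem_harmonic b hL hp2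
  refine ⟨hharm, hessian_degOneCoord_symm b hp2, fun A B hAB => ?_⟩
  by_cases hA : A.card = 4
  swap
  · exact (hharm B).1 A hA
  by_cases hB : B.card = 4
  swap
  · rw [hessian_degOneCoord_symm b hp2]; exact (hharm A).1 B hB
  by_cases h3 : 3 ≤ (A ∩ B).card
  · exact hessian_eq_zero_of_three_le b hL hp h3
  -- A 4-set `B` meeting `A` in at most one point meets `Aᶜ` in at least three, and complementing
  -- `A` does not change the value.
  · have h4 : 3 ≤ (Aᶜ ∩ B).card := by
      have h5 := Finset.card_sdiff_add_card_inter B A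
      have h6 : Aᶜ ∩ B = B \ A := by ext x; simp [and_comm]
      rw [h6, Finset.inter_comm A B] at *
      omega
    rw [← hessian_eq_zero_of_three_le b hL hp h4]
    exact (harmonic_compl hL (hharm B) A).symm

/-- The values of a family of linear functionals on the matchings without crossings. -/
def planarValuesHom {S : Type*} [AddCommMonoid S] [Module k S]
    (h : Finset (Fin 8) → Finset (Fin 8) → S →ₗ[k] k) :
    S →ₗ[k] Fin planarMatchings.length → k where
  toFun p i := pairValue (fun A B => h A B p) planarMatchings[i]
  map_add' p q := by
    ext i
    rw [Pi.add_apply, ← pairValue_add]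
    simp only [map_add]
  map_smul' r p := by
    ext i
    rw [Pi.smul_apply, smul_eq_mul, RingHom.id_apply, ← pairValue_smul]
    simp only [map_smul, smul_eq_mul]

/-- The values of a quadratic relation on the matchings without crossings. -/
def planarValues (e : Fin 8 ≃ L) : relPiece k U L 2 →ₗ[k] Fin planarMatchings.length → k :=
  (planarValuesHom fun A B => hessian (degOneCoord b (A.map e.toEmbedding))
    (degOneCoord b (B.map e.toEmbedding))).domRestrict (relPiece k U L 2)

/-- This bounds the dimension of the quadratic relations by the number of planar matchings. -/
theorem planarValues_injective [CharZero k] (hL : Fintype.card L = 8) (e : Fin 8 ≃ L)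
    {κ : Type*} [Fintype κ] (c : Module.Basis κ k (invDegOne k U L)) :
    Function.Injective (planarValues (k := k) b e) := by
  rw [← LinearMap.ker_eq_bot, LinearMap.ker_eq_bot']
  intro p hp
  have hq := (isPairForm_hessian b hL p.2).relabel e
  have h0 := hq.eq_zero_of_planarMatchings fun m hm => by
    obtain ⟨i, hi, rfl⟩ := List.getElem_of_mem hm
    exact congrFun hp ⟨i, hi⟩
  refine Subtype.ext (eq_zero_of_hessian_eq_zero c (mem_relPiece_iff.1 p.2).2
    (span_degOneCoord b hL) ?_)
  rintro _ ⟨A, rfl⟩ _ ⟨B, rfl⟩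
  have h1 := congrFun (congrFun h0 (A.map e.symm.toEmbedding)) (B.map e.symm.toEmbedding)
  simpa [Finset.map_map] using h1

end QuadraticRelations

end PointsOnLine

end

/-! ### Conclusion by comparing dimensions -/

theorem mainTheorem6 {k : Type*} [Field k] [CharZero k]
    {U : Type*} [AddCommGroup U] [Module k U] (hU : Module.finrank k U = 2)
    {L : Type*} [Fintype L] [DecidableEq L] (hL : Fintype.card L = 8)
    (s : SymmetricAlgebra k (PointsOnLine.invDegOne k U L))
    (hs3 : s ∈ PointsOnLine.symPow k (PointsOnLine.invDegOne k U L) 3)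
    (hs0 : s ≠ 0) (hs : PointsOnLine.IsSkewInvariant s) :
    Module.finrank k (PointsOnLine.invDegOne k U L) = 14 ∧
    ∀ b : Module.Basis (Fin 14) k (PointsOnLine.invDegOne k U L),
      LinearIndependent k (fun i => PointsOnLine.partialDeriv k (b.coord i) s) ∧
      Submodule.span k (Set.range fun i => PointsOnLine.partialDeriv k (b.coord i) s) =
        PointsOnLine.relPiece k U L 2 := by
  have : Module.Finite k U := Module.finite_of_finrank_pos (by omega)
  let u : Module.Basis (Fin 2) k U := Module.finBasisOfFinrankEq k U hU
  obtain ⟨e⟩ : Nonempty (Fin 8 ≃ L) := Fintype.card_eq.1 (by simp [hL])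
  refine ⟨PointsOnLine.finrank_invDegOne u hL, fun b => ?_⟩
  have hli : LinearIndependent k (fun i => PointsOnLine.partialDeriv k (b.coord i) s) :=
    (PointsOnLine.linearIndependent_coord b).map_injOn (PointsOnLine.partialDerivHom s)
      (PointsOnLine.partialDerivHom_injective u hL hs3 hs0 hs b).injOn
  have hinj := PointsOnLine.planarValues_injective u hL e b
  have hfin : Module.Finite k (PointsOnLine.relPiece k U L 2) :=
    Module.Finite.of_injective _ hinj
  refine ⟨hli, Submodule.eq_of_le_of_finrank_le ?_ ?_⟩
  · rw [Submodule.span_le]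
    rintro _ ⟨i, rfl⟩
    exact PointsOnLine.partialDeriv_mem_relPiece u hL hs3 hs _
  -- The 14 independent derivatives meet the upper bound of 14 planar matchings.
  · rw [finrank_span_eq_card hli, Fintype.card_fin]
    refine (LinearMap.finrank_le_finrank_of_injective hinj).trans ?_
    rw [Module.finrank_fin_fun, PointsOnLine.length_planarMatchings]
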